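/- A (finite) pre-semifield is a finite abelian group $(S,+)$ with a biadditive multiplication $\circ$ without zero divisors; it is a semifield if $\circ$ has a two-sided identity. Two pre-semifields are isotopic if $N_1(x\circ_1 y)=N_2(x)\circ_2N_3(y)$ for additive bijections $N_1,N_2,N_3$. The dual $\pi_1(S)$ has multiplication $(x,y)\mapsto y\circ x$; the transpose $\pi_2(S)$ has the multiplication $\circ^t$ with $B(a\circ^t y,x)=B(a,x\circ y)$ for a nondegenerate symmetric $\mathbb F_p$-bilinear form $B$ on $S$ (it is the pre-semifield belonging to the dual spread, and is unique up to isotopy). $S_1$ is equivalent to $S_2$ if $S_1$ is isotopic to a member of the Knuth orbit $\{S_2,\pi_1S_2,\pi_2S_2,\pi_2\pi_1S_2,\pi_1\pi_2S_2,\pi_1\pi_2\pi_1S_2\}$. Let $L=\mathbb F_{p^m}$, let $\sigma,\tau$ be automorphisms of $L$ with $\tau\ne\mathrm{id}$, $\sigma^2\neq\mathrm{id}$, let $K$ be the fixed field of $\sigma$, and let $\alpha,\eta\in L$ with $\alpha\notin L^{\sigma+1}(L^{*})^{\tau-1}$ (in particular $\alpha\ne0$) and $N_{L:K}(\eta)\neq1$.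 Let $\mathcal S_{\sigma,\tau,\alpha,\eta}$ be $L^2$ with the multiplication $$\begin{pmatrix}x_0\\x_1\end{pmatrix}\circ\begin{pmatrix}y_0\\y_1\end{pmatrix}=\begin{pmatrix}x_1y_1^\sigma-\eta x_1^\sigma y_1+\alpha\,(x_0y_0^\sigma-\eta^{\tau^{-1}}x_0^\sigma y_0)\\ x_0^\tau y_1+x_1y_0^\tau\end{pmatrix}.$$ The known semifields of order $p^{2m}$ are understood to be the following, in each case with all parameters for which the product is a pre-semifield (and with $\overline\sigma=\sigma^{-1}$, all Greek letters as exponents being automorphisms of $L$ unless stated otherwise): 1. all commutative pre-semifields (among them finite fields and the commutative semifields of Ganley, Cohen–Ganley, Kantor, Budaghyan–Helleseth, Zha–Kyureghyan–Wang, Bierbrauer); 2. all semifields one of whose left, middle and right nuclei has at least $p^m$ elements; 3. generalized Dickson: $(x_0y_0+\alpha x_1^\rho y_1^\tau,\ x_0^\sigma y_1+x_1y_0)$; 4. Knuth I–IV: $(x_0y_0+\alpha x_1^{\sigma}y_1^{\overline\sigma^2},\ x_1y_0+x_0^\sigma y_1+\beta x_1^\sigma y_1^{\overline\sigma})$, $(x_0y_0+\alpha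 x_1^{\sigma}y_1,\ x_1y_0+x_0^\sigma y_1+\beta x_1^\sigma y_1)$, $(x_0y_0+\alpha x_1^{\overline\sigma}y_1^{\overline\sigma^2},\ x_1y_0+x_0^\sigma y_1+\beta x_1 y_1^{\overline\sigma})$, $(x_0y_0+\alpha x_1^{\overline\sigma}y_1,\ x_1y_0+x_0^\sigma y_1+\beta x_1y_1)$; 5. Bierbrauer: $(\delta x_1y_1^\sigma+\gamma x_0y_1^\sigma+\beta x_1y_0^\sigma+\alpha x_0y_0^\sigma+\eta(\delta x_1^\sigma y_1-\gamma x_1^\sigma y_0-\beta x_0^\sigma y_1+\alpha x_0^\sigma y_0),\ x_0y_1+x_1y_0)$; 6. Dempwolff: $(x_0y_0+x_1y_1^\sigma-\eta x_1^\tau y_1^{\overline\sigma},\ x_0y_1+\alpha(x_1y_0^\sigma-\eta x_1^\tau y_0^{\overline\sigma}))$ with $\alpha$ a non-square of $L$ fixed by $\sigma$; and, more generally, $x_0\mathbf y+x_1T(\mathbf y)+\eta x_1^\tau T^{-1}(\mathbf y)$ with any irreducible $T\in\Gamma L(2,L)$; 7. Zhou–Pott: $(x_0^\sigma y_0+x_0y_0^\sigma+\alpha(x_1^\sigma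 y_1+x_1y_1^\sigma)^\tau,\ x_0y_1+x_1y_0)$; 8. Taniguchi: $((x_0^\sigma y_0-\eta x_0y_0^\sigma)^{\sigma^2}+\beta(x_0^\sigma y_1+\eta y_0^\sigma x_1)^\sigma+\alpha(x_1^\sigma y_1-\eta x_1y_1^\sigma),\ x_1y_0+x_0y_1)$; 9. Albert's generalized twisted fields: $xy-c\,x^\sigma y^\tau$ on $\mathbb F_{p^{2m}}$, with $\sigma,\tau$ automorphisms of $\mathbb F_{p^{2m}}$; 10. (twisted) cyclic semifields: $\sum_{i<d}y_iT^i(\mathbf x)+\eta y_0^\rho T^d(\mathbf x)$ on $(\mathbb F_{p^n})^d$, where $d\ge 1$, $dn=2m$, $T\in\Gamma L(d,\mathbb F_{p^n})$ is irreducible and $\rho$ is an automorphism of $\mathbb F_{p^n}$. **Theorem.** The family $\mathcal S_{\sigma,\tau,\alpha,\eta}$ contains semifields that are not equivalent to any known semifield. More precisely, for every odd prime $p$ there are infinitely many $m$ for which there are parameters as above, with moreover $\eta^\tau=\eta$, such that $\mathcal S_{\sigma,\tau,\alpha,\eta}$ is a pre-semifield that is not equivalent to any known semifield of order $p^{2m}$.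 -/

import Mathlib

/-! ## Finite (pre-)semifields, isotopy, Knuth orbit, nuclei

The additive group of the semifield is the ambient type `V`; the multiplication is a function
`mul : V → V → V`. -/

namespace Semifields

/-- A pre-semifield: a biadditive multiplication without zero divisors. -/
structure IsPresemifield {V : Type*} [AddCommGroup V] (mul : V → V → V) : Prop where
  mul_add : ∀ x y z, mul x (y + z) = mul x y + mul x z
  add_mul : ∀ x y z, mul (x + y) z = mul x z + mul y z
  eq_zero_or_eq_zero : ∀ x y, mul x y = 0 → x = 0 ∨ y = 0

/-- A semifield: a pre-semifield with a two-sided identity. -/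
structure IsSemifield {V : Type*} [AddCommGroup V] (mul : V → V → V) : Prop
    extends IsPresemifield mul where
  exists_one : ∃ e, ∀ x, mul x e = x ∧ mul e x = x

/-- Isotopy. For elementary abelian `p`-groups, additive bijections are the same as
`𝔽_p`-linear bijections. -/
def Isotopic {V W : Type*} [AddCommGroup V] [AddCommGroup W]
    (mul₁ : V → V → V) (mul₂ : W → W → W) : Prop :=
  ∃ N₁ N₂ N₃ : V ≃+ W, ∀ x y, N₁ (mul₁ x y) = mul₂ (N₂ x) (N₃ y)

/-- The dual `π₁` of a semifield: the opposite multiplication. -/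
def dualMul {V : Type*} (mul : V → V → V) : V → V → V := fun x y => mul y x

/-- `mul'` is a transpose `π₂` of `mul`. The spread of `mul` consists of `{(x, mul x y) | x}`
for `y ∈ V` and `{(0, x) | x}`. With respect to the alternating form
`((u, w), (a, c)) ↦ B c u - B a w` on `V × V`, where `B` is a symmetric nondegenerate
`𝔽_p`-bilinear form on `V`, the dual spread consists of `{(a, mul' a y) | a}` and `{(0, x) | x}`
with `mul'` determined by the identity below.
Different choices of `B` lead to isotopic transposes. -/
def IsTranspose (p : ℕ) {V : Type*} [AddCommGroup V] (mul mul' : V → V → V) : Prop :=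
  ∃ B : V →+ V →+ ZMod p,
    (∀ x y, B x y = B y x) ∧ (∀ x, (∀ y, B x y = 0) → x = 0) ∧
    ∀ x a y, B (mul' a y) x = B a (mul x y)

/-- `mul'` is in the Knuth orbit of `mul`: it is one of
`S, π₁ S, π₂ S, π₂ π₁ S, π₁ π₂ S, π₁ π₂ π₁ S`. -/
def InKnuthOrbit (p : ℕ) {V : Type*} [AddCommGroup V] (mul mul' : V → V → V) : Prop :=
  mul' = mul ∨ mul' = dualMul mul ∨ IsTranspose p mul mul' ∨ IsTranspose p (dualMul mul) mul' ∨
    (∃ f, IsTranspose p mul f ∧ mul' = dualMul f) ∨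
    (∃ f, IsTranspose p (dualMul mul) f ∧ mul' = dualMul f)

/-- Equivalence: `mul₁` is isotopic to a member of the Knuth orbit of `mul₂`. -/
def Equivalent (p : ℕ) {V W : Type*} [AddCommGroup V] [AddCommGroup W]
    (mul₁ : V → V → V) (mul₂ : W → W → W) : Prop :=
  ∃ f : W → W → W, InKnuthOrbit p mul₂ f ∧ Isotopic mul₁ f

/-- Left nucleus. -/
def leftNucleus {V : Type*} (mul : V → V → V) : Set V :=
  {x | ∀ y z, mul (mul x y) z = mul x (mul y z)}

/-- Middle nucleus. -/
def middleNucleus {V : Type*} (mul : V → V → V) : Set V :=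
  {y | ∀ x z, mul (mul x y) z = mul x (mul y z)}

/-- Right nucleus. -/
def rightNucleus {V : Type*} (mul : V → V → V) : Set V :=
  {z | ∀ x y, mul (mul x y) z = mul x (mul y z)}

section Field

variable {L : Type*} [Field L]

/-- The norm from a finite field `L` to the fixed field of its automorphism `σ`,
i.e. `x · σ(x) ⋯ σ^{t-1}(x)` with `t` the order of `σ`. -/
noncomputable def fixedNorm (σ : RingAut L) (x : L) : L :=
  ∏ i ∈ Finset.range (orderOf σ), (σ ^ i) x

/-! ## The new family -/

/-- The multiplication of `𝒮_{σ,τ,α,η}` on `L × L`. -/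
def newMul (σ τ : RingAut L) (α η : L) : L × L → L × L → L × L := fun x y =>
  (x.2 * σ y.2 - η * σ x.2 * y.2 + α * (x.1 * σ y.1 - τ.symm η * σ x.1 * y.1),
   τ x.1 * y.2 + x.2 * τ y.1)

/-- The parameters of the new family: `τ ≠ id`, `σ² ≠ id`, `α ∉ L^{σ+1} L^{τ-1}`
(for `a = 0` this says `α ≠ 0`), and the norm of `η` to the fixed field of `σ` is not `1`. -/
structure IsNewParameter (σ τ : RingAut L) (α η : L) : Prop where
  tau_ne : τ ≠ 1
  sigma_sq_ne : σ ^ 2 ≠ 1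
  alpha_notMem : ∀ a b : L, b ≠ 0 → α ≠ (σ a * a) * (τ b / b)
  norm_ne : fixedNorm σ η ≠ 1

/-! ## The multiplications of the known families -/

/-- Generalized Dickson. -/
def dicksonMul (σ τ ρ : RingAut L) (α : L) : L × L → L × L → L × L := fun x y =>
  (x.1 * y.1 + α * ρ x.2 * τ y.2, σ x.1 * y.2 + x.2 * y.1)

/-- Knuth, type I. -/
def knuthIMul (σ : RingAut L) (α β : L) : L × L → L × L → L × L := fun x y =>
  (x.1 * y.1 + α * σ x.2 * σ.symm (σ.symm y.2),
   x.2 * y.1 + σ x.1 * y.2 + β * σ x.2 * σ.symm y.2)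

/-- Knuth, type II (Hughes-Kleinfeld). -/
def knuthIIMul (σ : RingAut L) (α β : L) : L × L → L × L → L × L := fun x y =>
  (x.1 * y.1 + α * σ x.2 * y.2,
   x.2 * y.1 + σ x.1 * y.2 + β * σ x.2 * y.2)

/-- Knuth, type III. -/
def knuthIIIMul (σ : RingAut L) (α β : L) : L × L → L × L → L × L := fun x y =>
  (x.1 * y.1 + α * σ.symm x.2 * σ.symm (σ.symm y.2),
   x.2 * y.1 + σ x.1 * y.2 + β * x.2 * σ.symm y.2)

/-- Knuth, type IV. -/
def knuthIVMul (σ : RingAut L) (α β : L) : L × L → L × L → L × L := fun x y =>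
  (x.1 * y.1 + α * σ.symm x.2 * y.2,
   x.2 * y.1 + σ x.1 * y.2 + β * x.2 * y.2)

/-- Bierbrauer (containing Budaghyan-Helleseth). -/
def bierbrauerMul (σ : RingAut L) (α β γ δ η : L) : L × L → L × L → L × L := fun x y =>
  (δ * x.2 * σ y.2 + γ * x.1 * σ y.2 + β * x.2 * σ y.1 + α * x.1 * σ y.1
      + η * (δ * σ x.2 * y.2 - γ * σ x.2 * y.1 - β * σ x.1 * y.2 + α * σ x.1 * y.1),
   x.1 * y.2 + x.2 * y.1)

/-- Dempwolff. -/
def dempwolffMul (σ τ : RingAut L) (α η : L) : L × L → L × L → L × L := fun x y =>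
  (x.1 * y.1 + x.2 * σ y.2 - η * τ x.2 * σ.symm y.2,
   x.1 * y.2 + α * (x.2 * σ y.1 - η * τ x.2 * σ.symm y.1))

/-- Zhou-Pott. -/
def zhouPottMul (σ τ : RingAut L) (α : L) : L × L → L × L → L × L := fun x y =>
  (σ x.1 * y.1 + x.1 * σ y.1 + α * τ (σ x.2 * y.2 + x.2 * σ y.2),
   x.1 * y.2 + x.2 * y.1)

/-- Taniguchi. -/
def taniguchiMul (σ : RingAut L) (α β η : L) : L × L → L × L → L × L := fun x y =>
  (σ (σ (σ x.1 * y.1 - η * x.1 * σ y.1)) + β * σ (σ x.1 * y.2 + η * σ y.1 * x.2)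
      + α * (σ x.2 * y.2 - η * x.2 * σ y.2),
   x.2 * y.1 + x.1 * y.2)

/-- Albert's generalized twisted fields. -/
def albertMul (σ τ : RingAut L) (c : L) : L → L → L := fun x y =>
  x * y - c * σ x * τ y

/-- The semilinear map `v ↦ M v^σ` on `L^d`. -/
def semilin {d : ℕ} (σ : RingAut L) (M : Matrix (Fin d) (Fin d) L) (v : Fin d → L) : Fin d → L :=
  M.mulVec (fun i => σ (v i))

/-- The inverse of `semilin σ M` when `M` is invertible. -/
noncomputable def semilinInv {d : ℕ} (σ : RingAut L) (M : Matrix (Fin d) (Fin d) L) (v : Fin d → L) :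
    Fin d → L :=
  fun i => σ.symm (M⁻¹.mulVec v i)

/-- `v ↦ M v^σ` is an irreducible element of `ΓL(d, L)`. -/
def IsIrreducibleSemilin {d : ℕ} (σ : RingAut L) (M : Matrix (Fin d) (Fin d) L) : Prop :=
  IsUnit M.det ∧ ∀ U : Submodule L (Fin d → L), (∀ v ∈ U, semilin σ M v ∈ U) → U = ⊥ ∨ U = ⊤

/-- (Twisted) cyclic semifields: `x ∘ y = ∑_{i<d} y_i T^i x + η y_0^ρ T^d x`. -/
def twistedCyclicMul {d : ℕ} (hd : 0 < d) (σ ρ : RingAut L) (M : Matrix (Fin d) (Fin d) L)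
    (η : L) : (Fin d → L) → (Fin d → L) → (Fin d → L) := fun x y =>
  ∑ i : Fin d, y i • (semilin σ M)^[(i : ℕ)] x
    + (η * ρ (y ⟨0, hd⟩)) • (semilin σ M)^[d] x

/-- The form `x ∘ y = x_0 y + x_1 T y + η x_1^τ T⁻¹ y` of the Dempwolff semifields. -/
noncomputable def dempwolffFormMul (σ τ : RingAut L) (M : Matrix (Fin 2) (Fin 2) L) (η : L) :
    (Fin 2 → L) → (Fin 2 → L) → (Fin 2 → L) := fun x y =>
  x 0 • y + x 1 • semilin σ M y + (η * τ (x 1)) • semilinInv σ M y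

end Field

/-- The known semifields of order `p^{2m}`. The named families are taken with all parameters for
which the displayed multiplication is a pre-semifield, so that every published choice of
parameters is included. `commutative` contains the finite fields and the semifields of
Ganley, Cohen-Ganley, Kantor(-Knuth), Budaghyan-Helleseth, Zha-Kyureghyan-Wang, …;
`largeNucleus` contains all families of semifields that are at most two-dimensional over one of
their nuclei, such as those of Cardinali-Polverino-Trombetti and
Ebert-Marino-Polverino-Trombetti. -/
inductive IsKnown (p m : ℕ) [Fact p.Prime] :
    {W : Type} → [AddCommGroup W] → (W → W → W) → Prop
  | commutative {W : Type} [AddCommGroup W] (f : W → W → W) (hcard : Nat.card W = p ^ (2 * m))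
      (hf : IsPresemifield f) (hcomm : ∀ x y, f x y = f y x) : IsKnown p m f
  | largeNucleus {W : Type} [AddCommGroup W] (f : W → W → W) (hcard : Nat.card W = p ^ (2 * m))
      (hf : IsSemifield f)
      (hnuc : p ^ m ≤ Nat.card (leftNucleus f) ∨ p ^ m ≤ Nat.card (middleNucleus f) ∨
        p ^ m ≤ Nat.card (rightNucleus f)) : IsKnown p m f
  | dickson (σ τ ρ : RingAut (GaloisField p m)) (α : GaloisField p m)
      (hf : IsPresemifield (dicksonMul σ τ ρ α)) : IsKnown p m (dicksonMul σ τ ρ α)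
  | knuthI (σ : RingAut (GaloisField p m)) (α β : GaloisField p m)
      (hf : IsPresemifield (knuthIMul σ α β)) : IsKnown p m (knuthIMul σ α β)
  | knuthII (σ : RingAut (GaloisField p m)) (α β : GaloisField p m)
      (hf : IsPresemifield (knuthIIMul σ α β)) : IsKnown p m (knuthIIMul σ α β)
  | knuthIII (σ : RingAut (GaloisField p m)) (α β : GaloisField p m)
      (hf : IsPresemifield (knuthIIIMul σ α β)) : IsKnown p m (knuthIIIMul σ α β)
  | knuthIV (σ : RingAut (GaloisField p m)) (α β : GaloisField p m)
      (hf : IsPresemifield (knuthIVMul σ α β)) : IsKnown p m (knuthIVMul σ α β)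
  | bierbrauer (σ : RingAut (GaloisField p m)) (α β γ δ η : GaloisField p m)
      (hf : IsPresemifield (bierbrauerMul σ α β γ δ η)) :
      IsKnown p m (bierbrauerMul σ α β γ δ η)
  | dempwolff (σ τ : RingAut (GaloisField p m)) (α η : GaloisField p m)
      (hfix : σ α = α) (hsq : ¬ IsSquare α)
      (hf : IsPresemifield (dempwolffMul σ τ α η)) : IsKnown p m (dempwolffMul σ τ α η)
  | dempwolffForm (σ τ : RingAut (GaloisField p m))
      (M : Matrix (Fin 2) (Fin 2) (GaloisField p m)) (η : GaloisField p m)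
      (hM : IsIrreducibleSemilin σ M) (hf : IsPresemifield (dempwolffFormMul σ τ M η)) :
      IsKnown p m (dempwolffFormMul σ τ M η)
  | zhouPott (σ τ : RingAut (GaloisField p m)) (α : GaloisField p m)
      (hf : IsPresemifield (zhouPottMul σ τ α)) : IsKnown p m (zhouPottMul σ τ α)
  | taniguchi (σ : RingAut (GaloisField p m)) (α β η : GaloisField p m)
      (hf : IsPresemifield (taniguchiMul σ α β η)) : IsKnown p m (taniguchiMul σ α β η)
  | albert (σ τ : RingAut (GaloisField p (2 * m))) (c : GaloisField p (2 * m))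
      (hf : IsPresemifield (albertMul σ τ c)) : IsKnown p m (albertMul σ τ c)
  | twistedCyclic (d n : ℕ) (hd : 0 < d) (hdn : d * n = 2 * m)
      (σ ρ : RingAut (GaloisField p n)) (M : Matrix (Fin d) (Fin d) (GaloisField p n))
      (η : GaloisField p n) (hM : IsIrreducibleSemilin σ M)
      (hf : IsPresemifield (twistedCyclicMul hd σ ρ M η)) :
      IsKnown p m (twistedCyclicMul hd σ ρ M η)

end Semifields

namespace Semifields
open Finset

/-! ## Sums of field automorphisms -/

section Homs

variable {L : Type*} [Field L]

theorem ringHom_add_eq_add (h2 : (2 : L) ≠ 0) {θ₁ θ₂ χ₁ χ₂ : L →+* L}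
    (h : ∀ a, θ₁ a + θ₂ a = χ₁ a + χ₂ a) :
    (θ₁ = χ₁ ∧ θ₂ = χ₂) ∨ (θ₁ = χ₂ ∧ θ₂ = χ₁) := by
  have hprod : ∀ a, (θ₁ a - χ₁ a) * (θ₁ a - χ₂ a) = 0 := by
    intro a
    have h1 := h a
    have h3 := h (a * a)
    simp only [map_mul] at h3
    have h4 : 2 * ((θ₁ a - χ₁ a) * (θ₁ a - χ₂ a)) = 0 := by
      linear_combination h3 + (θ₁ a - χ₁ a - χ₂ a - θ₂ a) * h1
    exact (mul_eq_zero.1 h4).resolve_left h2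
  by_cases h1 : ∀ a, θ₁ a = χ₁ a
  · refine Or.inl ⟨RingHom.ext h1, RingHom.ext fun a => ?_⟩
    have := h a
    rw [h1 a] at this
    exact add_left_cancel this
  · push Not at h1
    obtain ⟨b, hb⟩ := h1
    have hb' : θ₁ b = χ₂ b :=
      sub_eq_zero.1 ((mul_eq_zero.1 (hprod b)).resolve_left (sub_ne_zero.2 hb))
    have h5 : ∀ a, θ₁ a = χ₂ a := by
      intro a
      by_contra ha
      have ha' : θ₁ a = χ₁ a :=
        sub_eq_zero.1 ((mul_eq_zero.1 (hprod a)).resolve_right (sub_ne_zero.2 ha))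
      have hab := hprod (a + b)
      simp only [map_add] at hab
      rcases mul_eq_zero.1 hab with h6 | h6
      · exact hb (by linear_combination h6 - ha')
      · exact ha (by linear_combination h6 - hb')
    refine Or.inr ⟨RingHom.ext h5, RingHom.ext fun a => ?_⟩
    have := h a
    rw [h5 a] at this
    linear_combination this

variable [Fintype (RingAut L)]

theorem ringAut_sum_eq_zero {c : RingAut L → L} (h : ∀ x, ∑ g, c g * g x = 0) (g : RingAut L) :
    c g = 0 := by
  have hli := (linearIndependent_monoidHom L L).comp
    (fun g : RingAut L => ((g : L →+* L) : L →* L)) (by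
      intro g h hgh
      ext x
      exact DFunLike.congr_fun hgh x)
  rw [Fintype.linearIndependent_iff] at hli
  refine hli c ?_ g
  ext x
  simpa using h x

theorem ringAut_sum_sum_eq_zero {M : RingAut L → RingAut L → L}
    (h : ∀ x y, ∑ g, ∑ k, M g k * (g x * k y) = 0) (g k : RingAut L) : M g k = 0 := by
  refine ringAut_sum_eq_zero (c := M g) (fun y => ?_) k
  refine ringAut_sum_eq_zero (c := fun g => ∑ k, M g k * k y) (fun x => ?_) g
  rw [← h x y]
  refine sum_congr rfl fun g _ => ?_
  rw [sum_mul]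
  exact sum_congr rfl fun k _ => by ring

theorem ringAut_sum_sum_ext {M N : RingAut L → RingAut L → L}
    (h : ∀ x y, ∑ g, ∑ k, M g k * (g x * k y) = ∑ g, ∑ k, N g k * (g x * k y))
    (g k : RingAut L) : M g k = N g k := by
  refine sub_eq_zero.1 (ringAut_sum_sum_eq_zero (M := fun g k => M g k - N g k) (fun x y => ?_) g k)
  simp only [sub_mul, sum_sub_distrib, h, sub_self]

end Homs

/-- Ring automorphisms are automorphisms over the prime field. -/
def ringAutEquivGal {L : Type*} [Field L] (p : ℕ) [Fact p.Prime] [Algebra (ZMod p) L] :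
    RingAut L ≃* (L ≃ₐ[ZMod p] L) where
  toFun g := AlgEquiv.ofRingEquiv (f := g) fun x => by
    have : ((g : L →+* L).comp (algebraMap (ZMod p) L)) = algebraMap (ZMod p) L :=
      RingHom.ext_zmod _ _
    exact DFunLike.congr_fun this x
  invFun g := g.toRingEquiv
  left_inv _ := rfl
  right_inv _ := rfl
  map_mul' _ _ := rfl

theorem finite_ringAut {L : Type*} [Field L] (p : ℕ) [Fact p.Prime] [Algebra (ZMod p) L]
    [Finite L] : Finite (RingAut L) :=
  Finite.of_equiv _ (ringAutEquivGal (L := L) p).symm.toEquiv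

theorem ringAut_mul_comm {L : Type*} [Field L] (p : ℕ) [Fact p.Prime] [Algebra (ZMod p) L]
    [Finite L] (g h : RingAut L) : g * h = h * g := by
  apply (ringAutEquivGal p).injective
  obtain ⟨f, hf⟩ := IsCyclic.exists_generator (α := Gal(L/ZMod p))
  obtain ⟨i, hi⟩ := hf (ringAutEquivGal p g)
  obtain ⟨j, hj⟩ := hf (ringAutEquivGal p h)
  rw [map_mul, map_mul, ← hi, ← hj]
  exact (zpow_mul_comm f i j)

theorem exists_ringAut_expansion {L : Type*} [Field L] (p : ℕ) [Fact p.Prime] [Algebra (ZMod p) L]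
    [Finite L] [Fintype (RingAut L)] (f : L →+ L) :
    ∃ c : RingAut L → L, ∀ x, f x = ∑ g, c g * g x := by
  have hcardG : Fintype.card (RingAut L) = Module.finrank (ZMod p) L := by
    rw [← IsGalois.card_aut_eq_finrank, ← Nat.card_eq_fintype_card]
    exact Nat.card_congr (ringAutEquivGal p).toEquiv
  let Φ : (RingAut L → L) → (L →ₗ[ZMod p] L) := fun c =>
    AddMonoidHom.toZModLinearMap p (AddMonoidHom.mk' (fun x => ∑ g, c g * g x) fun x y => by
      simp only [map_add, mul_add, sum_add_distrib])
  have hΦ : ∀ c x, Φ c x = ∑ g, c g * g x := fun c x => rfl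
  have hinj : Function.Injective Φ := by
    intro c d hcd
    funext g
    refine sub_eq_zero.1 (ringAut_sum_eq_zero (c := fun g => c g - d g) (fun x => ?_) g)
    have := DFunLike.congr_fun hcd x
    rw [hΦ, hΦ] at this
    simp only [sub_mul, sum_sub_distrib, this, sub_self]
  have : Finite (L →ₗ[ZMod p] L) := Module.finite_of_finite (ZMod p)
  have hcard : Nat.card (RingAut L → L) = Nat.card (L →ₗ[ZMod p] L) := by
    rw [Nat.card_fun, Module.natCard_eq_pow_finrank (K := ZMod p) (V := L →ₗ[ZMod p] L),
      Module.natCard_eq_pow_finrank (K := ZMod p) (V := L), Module.finrank_linearMap, ← pow_mul,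
      Nat.card_eq_fintype_card (α := RingAut L), hcardG]
  have hbij := (Nat.bijective_iff_injective_and_card Φ).2 ⟨hinj, hcard⟩
  obtain ⟨c, hc⟩ := hbij.2 (f.toZModLinearMap p)
  exact ⟨c, fun x => by rw [← hΦ, hc]; rfl⟩

/-! ## The derivations of the new family -/

section Derivations

variable {L : Type*} [Field L] [Fintype (RingAut L)]

open Classical in
/-- Coefficients of `κ (A x · σ y - η σ(A x) y) + μ (x σ(B y) - η σ x B y)`. -/
theorem twisted_expansion {σ : RingAut L} {κ μ η : L} {A B : L →+ L} {a b : RingAut L → L}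
    (hA : ∀ x, A x = ∑ g, a g * g x) (hB : ∀ x, B x = ∑ g, b g * g x) (x y : L) :
    κ * (A x * σ y - η * σ (A x) * y) + μ * (x * σ (B y) - η * σ x * B y) =
      ∑ g, ∑ k, (κ * (if k = σ then a g else 0)
        - κ * η * (if k = 1 then σ (a (σ⁻¹ * g)) else 0)
        + μ * (if g = 1 then σ (b (σ⁻¹ * k)) else 0)
        - μ * η * (if g = σ then b k else 0)) * (g x * k y) := by
  have hσ : ∀ (c : RingAut L → L) (z : L),
      σ (∑ g, c g * g z) = ∑ g, σ (c (σ⁻¹ * g)) * g z := by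
    intro c z
    rw [map_sum]
    refine Fintype.sum_equiv (Equiv.mulLeft σ) _ _ fun g => ?_
    simp
  have e1 : ∑ g, ∑ k, (if k = σ then a g else 0) * (g x * k y) = A x * σ y := by
    rw [hA, sum_mul]
    refine sum_congr rfl fun g _ => ?_
    simp [ite_mul, mul_assoc]
  have e2 : ∑ g : RingAut L, ∑ k : RingAut L,
      (if k = 1 then σ (a (σ⁻¹ * g)) else 0) * (g x * k y) = σ (A x) * y := by
    rw [hA, hσ, sum_mul]
    refine sum_congr rfl fun g _ => ?_
    simp [ite_mul, mul_assoc]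
  have e3 : ∑ g : RingAut L, ∑ k : RingAut L,
      (if g = 1 then σ (b (σ⁻¹ * k)) else 0) * (g x * k y) = x * σ (B y) := by
    rw [hB, hσ, mul_sum, sum_comm]
    refine sum_congr rfl fun g _ => ?_
    simp [ite_mul, mul_left_comm]
  have e4 : ∑ g, ∑ k, (if g = σ then b k else 0) * (g x * k y) = σ x * B y := by
    rw [hB, mul_sum, sum_comm]
    refine sum_congr rfl fun g _ => ?_
    simp [ite_mul, mul_left_comm]
  simp only [add_mul, sub_mul, sum_add_distrib, sum_sub_distrib, mul_assoc (κ * η),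
    mul_assoc (μ * η), mul_assoc κ (ite _ _ _), mul_assoc μ (ite _ _ _), ← mul_sum, e1, e2, e3, e4]
  ring

/-- If the expansion is supported away from certain monomials, `A` and `B` are scalar. -/
theorem twisted_support {σ : RingAut L} {κ μ η : L} {A B : L →+ L} (p : ℕ) [Fact p.Prime]
    [Algebra (ZMod p) L] [Finite L] (hκ : κ ≠ 0) (hμ : μ ≠ 0) (hη : η ≠ 0)
    (hσ1 : σ ≠ 1) (hσ2 : σ * σ ≠ 1)
    {R : RingAut L → RingAut L → L}
    (hR : ∀ x y, κ * (A x * σ y - η * σ (A x) * y) + μ * (x * σ (B y) - η * σ x * B y) =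
      ∑ g, ∑ k, R g k * (g x * k y))
    (hs1 : ∀ g, g ≠ 1 → R g σ = 0 ∨ R (σ * g) 1 = 0) (hs2 : R (σ * σ) 1 = 0)
    (hs3 : R σ⁻¹ σ = 0)
    (ht1 : ∀ g, g ≠ 1 → R σ g = 0 ∨ R 1 (σ * g) = 0) (ht2 : R 1 (σ * σ) = 0)
    (ht3 : R σ σ⁻¹ = 0) :
    (∃ a, ∀ x, A x = a * x) ∧ (∃ b, ∀ x, B x = b * x) ∧
      ∀ g k, (g ≠ 1 ∨ k ≠ σ) → (g ≠ σ ∨ k ≠ 1) → R g k = 0 := by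
  classical
  obtain ⟨a, ha⟩ := exists_ringAut_expansion p A
  obtain ⟨b, hb⟩ := exists_ringAut_expansion p B
  have hcoef := ringAut_sum_sum_ext (fun x y => (hR x y).symm.trans (twisted_expansion ha hb x y))
  have hinv : σ⁻¹ ≠ σ := fun h => hσ2 (by nth_rw 1 [← h]; exact inv_mul_cancel σ)
  have hinv1 : σ⁻¹ ≠ 1 := fun h => hσ1 (inv_eq_one.1 h)
  have hσσ : σ * σ ≠ σ := fun h => hσ1 (mul_eq_left.1 h)
  have c1 : ∀ g, g ≠ 1 → g ≠ σ → R g σ = 0 → a g = 0 := by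
    intro g h1 h2 h3
    have := hcoef g σ
    rw [h3] at this
    simpa [h1, h2, hσ1, hκ] using this.symm
  have c2 : ∀ g, σ * g ≠ 1 → g ≠ 1 → R (σ * g) 1 = 0 → a g = 0 := by
    intro g h1 h2 h3
    have := hcoef (σ * g) 1
    rw [h3] at this
    simpa [h1, h2, hσ1.symm, hκ, hη] using this.symm
  have d1 : ∀ g, g ≠ 1 → g ≠ σ → R σ g = 0 → b g = 0 := by
    intro g h1 h2 h3
    have := hcoef σ g
    rw [h3] at this
    simpa [h1, h2, hσ1, hμ, hη] using this.symm
  have d2 : ∀ g, σ * g ≠ 1 → g ≠ 1 → R 1 (σ * g) = 0 → b g = 0 := by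
    intro g h1 h2 h3
    have := hcoef 1 (σ * g)
    rw [h3] at this
    simpa [h1, h2, hσ1.symm, hμ, hη] using this.symm
  have ha0 : ∀ g, g ≠ 1 → a g = 0 := by
    intro g hg
    by_cases h1 : g = σ
    · exact c2 g (by rw [h1]; exact hσ2) hg (by rw [h1]; exact hs2)
    by_cases h2 : g = σ⁻¹
    · exact c1 g hg h1 (by rw [h2]; exact hs3)
    rcases hs1 g hg with h | h
    · exact c1 g hg h1 h
    · exact c2 g (fun h3 => h2 (eq_inv_of_mul_eq_one_right h3)) hg h
  have hb0 : ∀ g, g ≠ 1 → b g = 0 := by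
    intro g hg
    by_cases h1 : g = σ
    · exact d2 g (by rw [h1]; exact hσ2) hg (by rw [h1]; exact ht2)
    by_cases h2 : g = σ⁻¹
    · exact d1 g hg h1 (by rw [h2]; exact ht3)
    rcases ht1 g hg with h | h
    · exact d1 g hg h1 h
    · exact d2 g (fun h3 => h2 (eq_inv_of_mul_eq_one_right h3)) hg h
  refine ⟨⟨a 1, fun x => ?_⟩, ⟨b 1, fun x => ?_⟩, fun g k h1 h2 => ?_⟩
  · rw [ha, sum_eq_single 1 (fun g _ hg => by rw [ha0 g hg, zero_mul]) (by simp)]; rfl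
  · rw [hb, sum_eq_single 1 (fun g _ hg => by rw [hb0 g hg, zero_mul]) (by simp)]; rfl
  · have hi : ∀ g : RingAut L, g ≠ σ → σ⁻¹ * g ≠ 1 := fun g hg h =>
      hg (by simpa using (inv_mul_eq_one.1 h).symm)
    rw [hcoef]
    have z1 : (if k = σ then a g else 0) = 0 := by
      split_ifs with h
      · exact ha0 g (by tauto)
      · rfl
    have z2 : (if k = 1 then σ (a (σ⁻¹ * g)) else 0) = 0 := by
      split_ifs with h
      · rw [ha0 _ (hi g (by tauto)), map_zero]
      · rfl
    have z3 : (if g = 1 then σ (b (σ⁻¹ * k)) else 0) = 0 := by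
      split_ifs with h
      · rw [hb0 _ (hi k (by tauto)), map_zero]
      · rfl
    have z4 : (if g = σ then b k else 0) = 0 := by
      split_ifs with h
      · exact hb0 k (by tauto)
      · rfl
    rw [z1, z2, z3, z4]; ring

end Derivations

section Derivations

variable {L : Type*} [Field L] [Fintype (RingAut L)]

theorem zpow_inj_of_pow_ne_one {G : Type*} [Group G] {σ : G}
    (hσ : ∀ j : ℕ, 0 < j → j < 10 → σ ^ j ≠ 1)
    {i j : ℤ} (h : σ ^ i = σ ^ j) (hij : (i - j).natAbs < 10) : i = j := by
  by_contra hne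
  have h1 : σ ^ (i - j) = 1 := by rw [zpow_sub, h, mul_inv_cancel]
  refine hσ (i - j).natAbs (by omega) hij ?_
  rcases Int.natAbs_eq (i - j) with h2 | h2
  · rw [h2, zpow_natCast] at h1; exact h1
  · rw [h2, zpow_neg, zpow_natCast, inv_eq_one] at h1; exact h1

theorem twisted_scalar {σ : RingAut L} {κ η : L} {A B C : L →+ L} (p : ℕ) [Fact p.Prime]
    [Algebra (ZMod p) L] [Finite L] (hκ : κ ≠ 0) (hη : η ≠ 0)
    (hσ : ∀ j : ℕ, 0 < j → j < 10 → σ ^ j ≠ 1)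
    (h : ∀ x y, C (x * σ y - η * σ x * y) =
      κ * (A x * σ y - η * σ (A x) * y) + κ * (x * σ (B y) - η * σ x * B y)) :
    ∃ a b, (∀ x, A x = a * x) ∧ (∀ x, B x = b * x) ∧ (∀ x, C x = κ * (a + σ b) * x) ∧
      σ a + b = a + σ b := by
  classical
  have hz := fun {i j} => zpow_inj_of_pow_ne_one hσ (i := i) (j := j)
  obtain ⟨c, hc⟩ := exists_ringAut_expansion p C
  have hσ1 : σ ≠ 1 := by simpa using hσ 1
  let R : RingAut L → RingAut L → L := fun g k =>
    (if k = g * σ then c g else 0) - (if g = k * σ then c k * k η else 0)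
  have hR : ∀ x y, κ * (A x * σ y - η * σ (A x) * y) + κ * (x * σ (B y) - η * σ x * B y) =
      ∑ g, ∑ k, R g k * (g x * k y) := by
    intro x y
    rw [← h, hc]
    simp only [R, sub_mul, sum_sub_distrib, map_sub, map_mul, mul_sub]
    congr 1
    · refine sum_congr rfl fun g _ => ?_
      simp [ite_mul]
    · rw [sum_comm]
      refine sum_congr rfl fun g _ => ?_
      simp [ite_mul, mul_assoc]
  have hRz : ∀ g k, k ≠ g * σ → g ≠ k * σ → R g k = 0 := by
    intro g k h1 h2
    simp [R, h1, h2]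
  have hs1 : ∀ g, g ≠ 1 → (σ ≠ g * σ ∧ g ≠ σ * σ) ∨
      ((1 : RingAut L) ≠ σ * g * σ ∧ σ * g ≠ 1 * σ) := by
    intro g hg
    by_cases h1 : g = σ * σ
    · right
      subst h1
      constructor
      · intro h2
        have : σ ^ (0 : ℤ) = σ ^ (4 : ℤ) := by simpa [zpow_ofNat, pow_succ, mul_assoc] using h2
        exact absurd (hz this (by decide)) (by decide)
      · simpa using hg
    · exact Or.inl ⟨by simpa using hg, h1⟩
  have n30 : σ * σ * σ ≠ 1 := by simpa [pow_succ] using hσ 3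
  have n20 : σ * σ ≠ 1 := by simpa [pow_succ] using hσ 2
  have n3 : σ⁻¹ ≠ σ * σ := by
    intro h1
    exact n30 (by rw [← h1]; simp)
  obtain ⟨⟨a, ha⟩, ⟨b, hb⟩, hR0⟩ := twisted_support p hκ hκ hη hσ1 n20 hR
    (fun g hg => (hs1 g hg).imp (fun h => hRz _ _ h.1 h.2)
      (fun h => hRz _ _ h.1 h.2))
    (hRz _ _ (Ne.symm n30) (by simpa using hσ1))
    (hRz _ _ (by simpa using hσ1) n3)
    (fun g hg => (hs1 g hg).imp (fun h => hRz _ _ h.2 h.1) (fun h => hRz _ _ h.2 h.1))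
    (hRz _ _ (by simpa using hσ1) (Ne.symm n30))
    (hRz _ _ n3 (by simpa using hσ1))
  have hc0 : ∀ g, g ≠ 1 → c g = 0 := by
    intro g hg
    have h1 := hR0 g (g * σ) (Or.inl hg) (by
      by_contra hcon
      push Not at hcon
      rw [hcon.1] at hcon
      exact n20 hcon.2)
    have h2 : g ≠ g * σ * σ := fun h => n20 (by simpa [mul_assoc] using h)
    simpa [R, h2] using h1
  have hC : ∀ x, C x = c 1 * x := fun x => by
    rw [hc, sum_eq_single 1 (fun g _ hg => by rw [hc0 g hg, zero_mul]) (by simp)]; rfl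
  have key : ∀ y, (c 1 - κ * (a + σ b)) * σ y = η * (c 1 - κ * (σ a + b)) * y := by
    intro y
    have := h 1 y
    simp only [hC, ha, hb, map_mul, map_one] at this
    linear_combination this
  obtain ⟨y, hy⟩ : ∃ y, σ y ≠ y := by
    by_contra hcon
    push Not at hcon
    exact hσ1 (RingEquiv.ext hcon)
  have k1 := key 1
  simp only [map_one, mul_one] at k1
  have k2 := key y
  rw [← k1] at k2
  have k3 : c 1 - κ * (a + σ b) = 0 := by
    have : (c 1 - κ * (a + σ b)) * (σ y - y) = 0 := by linear_combination k2
    exact (mul_eq_zero.1 this).resolve_right (sub_ne_zero.2 hy)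
  rw [k3] at k1
  have k4 : c 1 - κ * (σ a + b) = 0 := (mul_eq_zero.1 k1.symm).resolve_left hη
  refine ⟨a, b, ha, hb, fun x => by rw [hC]; linear_combination k3 * x, ?_⟩
  exact mul_left_cancel₀ hκ (by linear_combination k3 - k4)

theorem twisted_cross {σ : RingAut L} {κ μ η : L} {A B D : L →+ L} (p : ℕ) [Fact p.Prime]
    [Algebra (ZMod p) L] [Finite L] (hκ : κ ≠ 0) (hμ : μ ≠ 0) (hη : η ≠ 0)
    (hσ : ∀ j : ℕ, 0 < j → j < 10 → σ ^ j ≠ 1)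
    (h : (∀ x y, D ((σ ^ 3) x * y) =
        κ * (A x * σ y - η * σ (A x) * y) + μ * (x * σ (B y) - η * σ x * B y)) ∨
      (∀ x y, D (x * (σ ^ 3) y) =
        κ * (A x * σ y - η * σ (A x) * y) + μ * (x * σ (B y) - η * σ x * B y))) :
    (∃ a, ∀ x, A x = a * x) ∧ (∃ b, ∀ x, B x = b * x) ∧ ∀ x, D x = 0 := by
  classical
  have hz := fun {i j} => zpow_inj_of_pow_ne_one hσ (i := i) (j := j)
  obtain ⟨d, hd⟩ := exists_ringAut_expansion p D
  have hσ1 : σ ≠ 1 := by simpa using hσ 1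
  have n20 : σ * σ ≠ 1 := by simpa [pow_succ] using hσ 2
  have q3 : σ * σ ≠ 1 * σ ^ 3 := fun h1 => by
    have : σ ^ (2 : ℤ) = σ ^ (3 : ℤ) := by simpa [zpow_ofNat, pow_succ, mul_assoc] using h1
    exact absurd (hz this (by decide)) (by decide)
  have q4 : (1 : RingAut L) ≠ σ * σ * σ ^ 3 := fun h1 => by
    have : σ ^ (0 : ℤ) = σ ^ (5 : ℤ) := by simpa [zpow_ofNat, pow_succ, mul_assoc] using h1
    exact absurd (hz this (by decide)) (by decide)
  have q5 : σ⁻¹ ≠ σ * σ ^ 3 := fun h1 => by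
    have : σ ^ (0 : ℤ) = σ ^ (5 : ℤ) := by
      have := congrArg (σ * ·) h1
      simpa [zpow_ofNat, pow_succ, mul_assoc] using this
    exact absurd (hz this (by decide)) (by decide)
  have q6 : σ ≠ σ⁻¹ * σ ^ 3 := fun h1 => by
    have : σ ^ (2 : ℤ) = σ ^ (3 : ℤ) := by
      have := congrArg (σ * ·) h1
      simpa [zpow_ofNat, pow_succ, mul_assoc] using this
    exact absurd (hz this (by decide)) (by decide)
  have q7 : σ ≠ 1 * σ ^ 3 := fun h1 => by
    have : σ ^ (1 : ℤ) = σ ^ (3 : ℤ) := by simpa [zpow_ofNat, pow_succ, mul_assoc] using h1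
    exact absurd (hz this (by decide)) (by decide)
  have q8 : (1 : RingAut L) ≠ σ * σ ^ 3 := fun h1 => by
    have : σ ^ (0 : ℤ) = σ ^ (4 : ℤ) := by simpa [zpow_ofNat, pow_succ, mul_assoc] using h1
    exact absurd (hz this (by decide)) (by decide)
  rcases h with h | h
  · let R : RingAut L → RingAut L → L := fun g k => if g = k * σ ^ 3 then d k else 0
    have hR : ∀ x y, κ * (A x * σ y - η * σ (A x) * y) + μ * (x * σ (B y) - η * σ x * B y) =
        ∑ g, ∑ k, R g k * (g x * k y) := by
      intro x y
      rw [← h, hd, sum_comm]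
      refine sum_congr rfl fun g _ => ?_
      simp [R, ite_mul]
    have hRz : ∀ g k, g ≠ k * σ ^ 3 → R g k = 0 := fun g k h1 => by simp [R, h1]
    obtain ⟨ha, hb, hR0⟩ := twisted_support p hκ hμ hη hσ1 n20 hR
      (fun g _ => or_iff_not_imp_right.2 fun h1 => hRz _ _ fun h2 => h1 (hRz _ _ (by
        intro h3
        subst h2
        rw [one_mul, ← mul_assoc] at h3
        exact n20 (mul_eq_right.1 h3))))
      (hRz _ _ q3) (hRz _ _ q5)
      (fun g _ => or_iff_not_imp_left.2 fun h1 => hRz _ _ fun h2 => h1 (hRz _ _ fun h3 => by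
        rw [mul_assoc, ← h3] at h2
        exact n20 h2.symm))
      (hRz _ _ q4) (hRz _ _ q6)
    refine ⟨ha, hb, fun x => ?_⟩
    rw [hd]
    refine sum_eq_zero fun g _ => ?_
    have := hR0 (g * σ ^ 3) g (by
      by_contra hcon
      push Not at hcon
      rw [hcon.2] at hcon
      exact q8 hcon.1.symm) (by
      by_contra hcon
      push Not at hcon
      rw [hcon.2] at hcon
      exact q7 hcon.1.symm)
    simp only [R, if_true] at this
    rw [this, zero_mul]
  · let R : RingAut L → RingAut L → L := fun g k => if k = g * σ ^ 3 then d g else 0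
    have hR : ∀ x y, κ * (A x * σ y - η * σ (A x) * y) + μ * (x * σ (B y) - η * σ x * B y) =
        ∑ g, ∑ k, R g k * (g x * k y) := by
      intro x y
      rw [← h, hd]
      refine sum_congr rfl fun g _ => ?_
      simp [R, ite_mul]
    have hRz : ∀ g k, k ≠ g * σ ^ 3 → R g k = 0 := fun g k h1 => by simp [R, h1]
    obtain ⟨ha, hb, hR0⟩ := twisted_support p hκ hμ hη hσ1 n20 hR
      (fun g _ => or_iff_not_imp_left.2 fun h1 => hRz _ _ fun h2 => h1 (hRz _ _ fun h3 => by
        rw [mul_assoc, ← h3] at h2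
        exact n20 h2.symm))
      (hRz _ _ q4) (hRz _ _ q6)
      (fun g _ => or_iff_not_imp_right.2 fun h1 => hRz _ _ fun h2 => h1 (hRz _ _ (by
        intro h3
        subst h2
        rw [one_mul, ← mul_assoc] at h3
        exact n20 (mul_eq_right.1 h3))))
      (hRz _ _ q3) (hRz _ _ q5)
    refine ⟨ha, hb, fun x => ?_⟩
    rw [hd]
    refine sum_eq_zero fun g _ => ?_
    have := hR0 g (g * σ ^ 3) (by
      by_contra hcon
      push Not at hcon
      rw [hcon.1] at hcon
      exact q7 hcon.2.symm) (by
      by_contra hcon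
      push Not at hcon
      rw [hcon.1] at hcon
      exact q8 hcon.2.symm)
    simp only [R, if_true] at this
    rw [this, zero_mul]

end Derivations

/-- The entries of an additive endomorphism of `L × L`. -/
theorem prod_hom_entries {L : Type*} [AddCommGroup L] (A : L × L →+ L × L) :
    ∃ A₁ A₂ A₃ A₄ : L →+ L, (∀ x, A (x, 0) = (A₁ x, A₃ x)) ∧ (∀ x, A (0, x) = (A₂ x, A₄ x)) ∧
      ∀ x, A x = (A₁ x.1 + A₂ x.2, A₃ x.1 + A₄ x.2) := by
  refine ⟨(AddMonoidHom.fst L L).comp (A.comp (AddMonoidHom.inl L L)),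
    (AddMonoidHom.fst L L).comp (A.comp (AddMonoidHom.inr L L)),
    (AddMonoidHom.snd L L).comp (A.comp (AddMonoidHom.inl L L)),
    (AddMonoidHom.snd L L).comp (A.comp (AddMonoidHom.inr L L)), fun x => by simp, fun x => by simp,
    fun x => ?_⟩
  have : A x = A (x.1, 0) + A (0, x.2) := by rw [← map_add]; simp
  rw [this]
  rfl

/-- The derivations of the new family. -/
theorem newMul_derivation {L : Type*} [Field L] (p : ℕ) [Fact p.Prime]
    [Algebra (ZMod p) L] [Finite L] {σ : RingAut L} {α η : L} (hα : α ≠ 0) (hη : η ≠ 0)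
    (hση : σ η = η) (hσ : ∀ j : ℕ, 0 < j → j < 10 → σ ^ j ≠ 1)
    (hodd : ∀ u, σ u = -u → u = 0) {A B C : L × L →+ L × L}
    (h : ∀ x y, C (newMul σ (σ ^ 3) α η x y) =
      newMul σ (σ ^ 3) α η (A x) y + newMul σ (σ ^ 3) α η x (B y)) :
    ∃ a b, σ (a - b) = a - b ∧ (∀ x, A x = (a * x.1, a * x.2)) ∧
      (∀ x, B x = (b * x.1, b * x.2)) ∧
      ∀ x, C x = ((a + σ b) * x.1, (a + (σ ^ 3) b) * x.2) := by
  have := finite_ringAut (L := L) p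
  have := Fintype.ofFinite (RingAut L)
  have hτη : (σ ^ 3).symm η = η := by
    rw [RingEquiv.symm_apply_eq]
    change η = σ (σ (σ η))
    simp [hση]
  have hτ1 : σ ^ 3 ≠ 1 := hσ 3 (by norm_num) (by norm_num)
  obtain ⟨z, hzτ⟩ : ∃ y, (σ ^ 3) y ≠ y := by
    by_contra hcon
    push Not at hcon
    exact hτ1 (RingEquiv.ext hcon)
  have hz := fun {i j} => zpow_inj_of_pow_ne_one hσ (i := i) (j := j)
  set τ := σ ^ 3 with hτ
  obtain ⟨A₁, A₂, A₃, A₄, hA1, hA2, hA⟩ := prod_hom_entries A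
  obtain ⟨B₁, B₂, B₃, B₄, hB1, hB2, hB⟩ := prod_hom_entries B
  obtain ⟨C₁, C₂, C₃, C₄, hC1, hC2, hC⟩ := prod_hom_entries C
  have h11 : ∀ x y, C₁ (α * (x * σ y - η * σ x * y)) =
      α * (A₁ x * σ y - η * σ (A₁ x) * y) + α * (x * σ (B₁ y) - η * σ x * B₁ y) ∧
      C₃ (α * (x * σ y - η * σ x * y)) = A₃ x * τ y + τ x * B₃ y := by
    intro x y
    have := h (x, 0) (y, 0)
    simp only [newMul, hτη, hA1, hB1, hC, map_zero, mul_zero, zero_mul, sub_zero, zero_add,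
      add_zero, Prod.mk_add_mk, Prod.mk.injEq] at this
    exact ⟨this.1.trans (by ring), this.2.trans (by ring)⟩
  have h22 : ∀ x y, C₁ (x * σ y - η * σ x * y) =
      1 * (A₄ x * σ y - η * σ (A₄ x) * y) + 1 * (x * σ (B₄ y) - η * σ x * B₄ y) ∧
      C₃ (x * σ y - η * σ x * y) = τ (A₂ x) * y + x * τ (B₂ y) := by
    intro x y
    have := h (0, x) (0, y)
    simp only [newMul, hτη, hA2, hB2, hC, map_zero, mul_zero, zero_mul, sub_zero, zero_add,
      add_zero, Prod.mk_add_mk, Prod.mk.injEq] at this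
    exact ⟨this.1.trans (by ring), this.2.trans (by ring)⟩
  have h12 : ∀ x y, C₂ (τ x * y) =
      1 * (A₃ x * σ y - η * σ (A₃ x) * y) + α * (x * σ (B₂ y) - η * σ x * B₂ y) ∧
      C₄ (τ x * y) = τ (A₁ x) * y + τ x * B₄ y := by
    intro x y
    have := h (x, 0) (0, y)
    simp only [newMul, hτη, hA1, hB2, hC, map_zero, mul_zero, zero_mul, sub_zero, zero_add,
      add_zero, Prod.mk_add_mk, Prod.mk.injEq] at this
    exact ⟨this.1.trans (by ring), this.2.trans (by ring)⟩
  have h21 : ∀ x y, C₂ (x * τ y) =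
      α * (A₂ x * σ y - η * σ (A₂ x) * y) + 1 * (x * σ (B₃ y) - η * σ x * B₃ y) ∧
      C₄ (x * τ y) = A₄ x * τ y + x * τ (B₁ y) := by
    intro x y
    have := h (0, x) (y, 0)
    simp only [newMul, hτη, hA2, hB1, hC, map_zero, mul_zero, zero_mul, sub_zero, zero_add,
      add_zero, Prod.mk_add_mk, Prod.mk.injEq] at this
    exact ⟨this.1.trans (by ring), this.2.trans (by ring)⟩
  obtain ⟨⟨a₃, hA3⟩, ⟨b₂, hB2'⟩, hC20⟩ :=
    twisted_cross p one_ne_zero hα hη hσ (Or.inl fun x y => (h12 x y).1)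
  obtain ⟨⟨a₂, hA2'⟩, ⟨b₃, hB3⟩, -⟩ :=
    twisted_cross p hα one_ne_zero hη hσ (Or.inr fun x y => (h21 x y).1)
  obtain ⟨a, b, hA4, hB4, hC1', hab⟩ :=
    twisted_scalar p one_ne_zero hη hσ fun x y => (h22 x y).1
  obtain ⟨a', b', hA1', hB1', hC1'', hab'⟩ :=
    twisted_scalar (C := C₁.comp (AddMonoidHom.mulLeft α)) p hα hη hσ fun x y => (h11 x y).1
  -- the off-diagonal entries vanish
  obtain ⟨ha2, hb2, hC3⟩ : a₂ = 0 ∧ b₂ = 0 ∧ ∀ x, C₃ x = 0 := by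
    classical
    obtain ⟨c, hc⟩ := exists_ringAut_expansion p C₃
    have hcoef := ringAut_sum_sum_ext
      (M := fun g k => (if k = g * σ then c g else 0) - (if g = k * σ then c k * k η else 0))
      (N := fun g k => (if g = τ then if k = 1 then τ a₂ else 0 else 0) +
        (if g = 1 then if k = τ then τ b₂ else 0 else 0)) (fun x y => by
          have := (h22 x y).2
          rw [hc, hA2', hB2'] at this
          simp only [sub_mul, sum_sub_distrib, map_sub, map_mul, mul_sub, add_mul,
            sum_add_distrib] at this ⊢
          have e1 : ∑ g : RingAut L, ∑ k : RingAut L, (if k = g * σ then c g else 0) * (g x * k y)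
              = ∑ g, c g * (g x * g (σ y)) := by
            refine sum_congr rfl fun g _ => ?_
            simp [ite_mul]
          have e2 : ∑ g : RingAut L, ∑ k : RingAut L,
              (if g = k * σ then c k * k η else 0) * (g x * k y)
              = ∑ g, c g * (g η * g (σ x) * g y) := by
            rw [sum_comm]
            refine sum_congr rfl fun g _ => ?_
            simp [ite_mul, mul_assoc]
          rw [e1, e2, this]
          simp [ite_mul]
          ring_nf)
    have m1 : (1 : RingAut L) ≠ τ * σ := fun h1 => by
      have : σ ^ (0 : ℤ) = σ ^ (4 : ℤ) := by
        simpa [hτ, zpow_ofNat, pow_succ, mul_assoc] using h1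
      exact absurd (hz this (by decide)) (by decide)
    have m2 : τ ≠ σ := fun h1 => by
      have : σ ^ (3 : ℤ) = σ ^ (1 : ℤ) := by
        simpa [hτ, zpow_ofNat, pow_succ, mul_assoc] using h1
      exact absurd (hz this (by decide)) (by decide)
    have t1 := hcoef τ 1
    have t2 := hcoef 1 τ
    simp only [m1, m2, hτ1, hτ1.symm, one_mul, if_true, if_false, sub_zero, zero_add, add_zero,
      ite_self] at t1 t2
    have t4 : a₂ = 0 := (map_eq_zero τ).1 t1.symm
    have t5 : b₂ = 0 := (map_eq_zero τ).1 t2.symm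
    refine ⟨t4, t5, fun x => ?_⟩
    rw [hc]
    refine sum_eq_zero fun g _ => ?_
    have t3 := hcoef g (g * σ)
    have m3 : σ * σ ≠ 1 := by simpa [pow_succ] using hσ 2
    simp [t4, t5, mul_assoc, m3] at t3
    rw [t3, zero_mul]
  obtain ⟨ha3, hb3⟩ : a₃ = 0 ∧ b₃ = 0 := by
    have k1 := (h11 1 1).2
    have k2 := (h11 1 z).2
    rw [hC3, hA3, hB3] at k1 k2
    simp only [map_one, mul_one, one_mul] at k1 k2
    have k3 : a₃ * (τ z - z) = 0 := by linear_combination z * k1 - k2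
    have k4 := (mul_eq_zero.1 k3).resolve_right (sub_ne_zero.2 hzτ)
    exact ⟨k4, by rw [k4] at k1; simpa using k1.symm⟩
  have hC4 : ∀ x, C₄ x = (τ a' + b) * x := fun x => by
    have := (h12 1 x).2
    rw [map_one, one_mul, hA1', hB4] at this
    rw [this]
    ring_nf
  have hC4' := (h21 1 1).2
  rw [map_one, one_mul, hA4, hB1', hC4] at hC4'
  simp only [mul_one, one_mul] at hC4'
  have hc1 : α * (a' + σ b') = α * (a + σ b) := by
    have h1 := hC1' (α * 1)
    have h2 := hC1'' 1
    change C₁ (α * 1) = _ at h2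
    rw [h1] at h2
    linear_combination -h2
  have hc2 := mul_left_cancel₀ hα hc1
  have hs : σ (a - b) = a - b := by rw [map_sub]; linear_combination hab
  have hs' : σ (a' - b') = a' - b' := by rw [map_sub]; linear_combination hab'
  have hτs' : τ (a' - b') = a' - b' := by
    change σ (σ (σ (a' - b'))) = _
    simp only [hs']
  have hss : a - b = a' - b' := by
    rw [map_sub] at hτs'
    linear_combination hτs' - hC4'
  have hu : a' - a = 0 := by
    apply hodd
    rw [map_sub] at hs hs' ⊢
    linear_combination hc2 + hs' - hs - hss
  have hu' : a' = a := sub_eq_zero.1 hu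
  have hub : b' = b := by rw [hu'] at hss; linear_combination hss
  refine ⟨a, b, hs, fun x => ?_, fun x => ?_, fun x => ?_⟩
  · rw [hA, hA1', hA2', hA3, hA4, ha2, ha3, hu']; simp
  · rw [hB, hB1', hB2', hB3, hB4, hb2, hb3, hub]; simp
  · have h5 : ∀ x, C₂ x = 0 := hC20
    rw [hC, hC1', h5, hC3, hC4]
    rw [hC4', hub]; simp

/-! ## Trilinear forms and their derivations -/

section Forms

/-- A symmetric nondegenerate bilinear form with values in the prime field. -/
structure IsInner {p : ℕ} {V : Type*} [AddCommGroup V] (B : V →+ V →+ ZMod p) : Prop where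
  symm : ∀ x y, B x y = B y x
  nondeg : ∀ x, (∀ y, B x y = 0) → x = 0

variable {p : ℕ} {V W : Type*} [AddCommGroup V] [AddCommGroup W]

theorem IsInner.ext {B : V →+ V →+ ZMod p} (hB : IsInner B) {x y : V} (h : ∀ z, B x z = B y z) :
    x = y := by
  refine sub_eq_zero.1 (hB.nondeg _ fun z => ?_)
  rw [map_sub, AddMonoidHom.sub_apply, h, sub_self]

theorem IsInner.exists_rep_of_module [Fact p.Prime] [Finite V] [Module (ZMod p) V]
    {B : V →+ V →+ ZMod p} (hB : IsInner B) (f : V →+ ZMod p) : ∃ v, ∀ x, B v x = f x := by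
  let Φ : V →ₗ[ZMod p] V →ₗ[ZMod p] ZMod p := LinearMap.mk₂ (ZMod p) (fun x y => B x y)
    (fun x y z => by rw [map_add, AddMonoidHom.add_apply])
    (fun c x y => ZMod.map_smul (B.flip y) c x)
    (fun x y z => map_add _ _ _) (fun c x y => ZMod.map_smul (B x) c y)
  have hΦ : ∀ x y, Φ x y = B x y := fun _ _ => rfl
  have hinj : Function.Injective Φ := fun x y hxy =>
    hB.ext fun z => by rw [← hΦ, hxy, hΦ]
  have : Module.Finite (ZMod p) V := Module.Finite.of_finite
  have hsurj := (LinearMap.injective_iff_surjective_of_finrank_eq_finrank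
    (Subspace.dual_finrank_eq (K := ZMod p) (V := V)).symm).1 hinj
  obtain ⟨v, hv⟩ := hsurj (f.toZModLinearMap p)
  exact ⟨v, fun x => by rw [← hΦ, hv]; rfl⟩

theorem IsInner.exists_rep [Fact p.Prime] [Finite V] {B : V →+ V →+ ZMod p} (hB : IsInner B)
    (f : V →+ ZMod p) : ∃ v, ∀ x, B v x = f x := by
  have htor : ∀ x : V, p • x = 0 := fun x => hB.nondeg _ fun y => by
    rw [map_nsmul, AddMonoidHom.nsmul_apply]; simp
  exact @IsInner.exists_rep_of_module p V _ _ _ (AddCommGroup.zmodModule htor) B hB f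

theorem IsInner.exists_adjoint [Fact p.Prime] [Finite V] {B : V →+ V →+ ZMod p} (hB : IsInner B)
    (B' : W →+ W →+ ZMod p) (Q : V →+ W) : ∃ R : W →+ V, ∀ w v, B (R w) v = B' w (Q v) := by
  choose R hR using fun w => hB.exists_rep ((B' w).comp Q)
  refine ⟨AddMonoidHom.mk' R fun x y => hB.ext fun z => ?_, hR⟩
  rw [map_add, AddMonoidHom.add_apply, hR, hR, hR, map_add]
  rfl

theorem IsInner.exists_adjoint_equiv [Fact p.Prime] [Finite V] [Finite W]
    {B : V →+ V →+ ZMod p} (hB : IsInner B)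
    {B' : W →+ W →+ ZMod p} (hB' : IsInner B') (Q : V ≃+ W) :
    ∃ R : W ≃+ V, ∀ w v, B (R w) v = B' w (Q v) := by
  obtain ⟨R, hR⟩ := hB.exists_adjoint B' (Q : V →+ W)
  have hinj : Function.Injective R := fun x y hxy => hB'.ext fun z => by
    have h1 := hR x (Q.symm z)
    have h2 := hR y (Q.symm z)
    rw [hxy, h2] at h1
    simpa using h1.symm
  have hbij := (Nat.bijective_iff_injective_and_card R).2 ⟨hinj, Nat.card_congr Q.symm.toEquiv⟩
  exact ⟨AddEquiv.ofBijective R hbij, hR⟩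

/-- The trilinear form of a multiplication. -/
def triForm (B : W →+ W →+ ZMod p) (f : W → W → W) (w : Fin 3 → W) : ZMod p :=
  B (f (w 0) (w 1)) (w 2)

/-- The derivations of a trilinear form. -/
def derivs (t : (Fin 3 → W) → ZMod p) : Set (Fin 3 → W →+ W) :=
  {D | ∀ w, ∑ i, t (Function.update w i (D i (w i))) = 0}

/-- Equivalence of trilinear forms, up to a permutation of the arguments. -/
structure SlotEquiv (t : (Fin 3 → V) → ZMod p) (t' : (Fin 3 → W) → ZMod p) where
  perm : Equiv.Perm (Fin 3)
  N : Fin 3 → V ≃+ W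
  eq : ∀ x, t x = t' fun i => N i (x (perm i))

def SlotEquiv.symm {t : (Fin 3 → V) → ZMod p} {t' : (Fin 3 → W) → ZMod p} (E : SlotEquiv t t') :
    SlotEquiv t' t where
  perm := E.perm.symm
  N i := (E.N (E.perm.symm i)).symm
  eq x := by rw [E.eq]; simp

/-- Transport of a family of endomorphisms along an equivalence. -/
def SlotEquiv.conj {t : (Fin 3 → V) → ZMod p} {t' : (Fin 3 → W) → ZMod p} (E : SlotEquiv t t')
    (D : Fin 3 → W →+ W) (j : Fin 3) : V →+ V :=
  ((E.N (E.perm.symm j)).symm : W →+ V).comp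
    ((D (E.perm.symm j)).comp (E.N (E.perm.symm j) : V →+ W))

theorem SlotEquiv.conj_apply {t : (Fin 3 → V) → ZMod p} {t' : (Fin 3 → W) → ZMod p}
    (E : SlotEquiv t t') (D : Fin 3 → W →+ W) (j : Fin 3) (x : V) :
    E.conj D j x = (E.N (E.perm.symm j)).symm (D (E.perm.symm j) (E.N (E.perm.symm j) x)) := rfl

theorem SlotEquiv.conj_mem {t : (Fin 3 → V) → ZMod p} {t' : (Fin 3 → W) → ZMod p}
    (E : SlotEquiv t t') {D : Fin 3 → W →+ W} (hD : D ∈ derivs t') : E.conj D ∈ derivs t := by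
  intro x
  rw [← Equiv.sum_comp E.perm, ← hD fun i => E.N i (x (E.perm i))]
  refine sum_congr rfl fun i _ => ?_
  rw [E.eq]
  congr 1
  funext j
  by_cases hj : j = i
  · subst hj
    simp [SlotEquiv.conj_apply]
  · simp [Function.update_of_ne hj, Function.update_of_ne (fun h => hj (E.perm.injective h))]

theorem SlotEquiv.conj_symm_conj {t : (Fin 3 → V) → ZMod p} {t' : (Fin 3 → W) → ZMod p}
    (E : SlotEquiv t t') (D : Fin 3 → W →+ W) : E.symm.conj (E.conj D) = D := by
  funext j
  ext x
  simp only [SlotEquiv.conj_apply, SlotEquiv.symm]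
  simp

theorem SlotEquiv.conj_injective {t : (Fin 3 → V) → ZMod p} {t' : (Fin 3 → W) → ZMod p}
    (E : SlotEquiv t t') : Function.Injective E.conj :=
  Function.LeftInverse.injective E.conj_symm_conj

theorem mem_derivs_triForm {B : W →+ W →+ ZMod p} {f : W → W → W} {D : Fin 3 → W →+ W} :
    D ∈ derivs (triForm B f) ↔
      ∀ x y z, B (f (D 0 x) y) z + B (f x (D 1 y)) z + B (f x y) (D 2 z) = 0 := by
  constructor
  · intro h x y z
    have := h ![x, y, z]
    simpa [Fin.sum_univ_three, triForm, Function.update] using this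
  · intro h w
    have := h (w 0) (w 1) (w 2)
    simpa [Fin.sum_univ_three, triForm, Function.update] using this

/-- A derivation of a multiplication gives one of its trilinear form. -/
theorem exists_mem_derivs [Fact p.Prime] [Finite W] {B : W →+ W →+ ZMod p} (hB : IsInner B)
    {f : W → W → W}
    {A A' C : W →+ W} (h : ∀ x y, C (f x y) = f (A x) y + f x (A' y)) :
    ∃ R : W →+ W, (∀ x y, B (R x) y = B x (C y)) ∧ ![A, A', -R] ∈ derivs (triForm B f) := by
  obtain ⟨R, hR⟩ := hB.exists_adjoint B C
  refine ⟨R, hR, mem_derivs_triForm.2 fun x y z => ?_⟩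
  change B (f (A x) y) z + B (f x (A' y)) z + B (f x y) (-(R z)) = 0
  rw [← AddMonoidHom.add_apply, ← map_add, ← h, map_neg,
    hB.symm (f x y) (R z), hR, hB.symm z]
  ring

/-- The converse. -/
theorem exists_derivation_of_mem [Fact p.Prime] [Finite W] {B : W →+ W →+ ZMod p} (hB : IsInner B)
    {f : W → W → W} {D : Fin 3 → W →+ W} (h : D ∈ derivs (triForm B f)) :
    ∃ C : W →+ W, (∀ x y, B (C x) y = B x (-D 2 y)) ∧
      ∀ x y, C (f x y) = f (D 0 x) y + f x (D 1 y) := by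
  obtain ⟨C, hC⟩ := hB.exists_adjoint B (-D 2)
  refine ⟨C, hC, fun x y => hB.ext fun z => ?_⟩
  have := mem_derivs_triForm.1 h x y z
  rw [hC, AddMonoidHom.neg_apply, map_neg, map_add, AddMonoidHom.add_apply]
  linear_combination -this

/-- Equivalent multiplications have equivalent trilinear forms. -/
theorem Equivalent.exists_slotEquiv [Fact p.Prime] [Finite V] {g : V → V → V} {f : W → W → W}
    {B₀ : V →+ V →+ ZMod p} (hB₀ : IsInner B₀) (h : Equivalent p g f) :
    ∃ B : W →+ W →+ ZMod p, IsInner B ∧ Finite W ∧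
      Nonempty (SlotEquiv (triForm B₀ g) (triForm B f)) := by
  obtain ⟨f', hf', N₁, N₂, N₃, hN⟩ := h
  have hW : Finite W := Finite.of_equiv V N₁.toEquiv
  -- the form transported from `V`
  let B₁ : W →+ W →+ ZMod p :=
    ((B₀.comp (N₁.symm : W →+ V)).flip.comp (N₁.symm : W →+ V)).flip
  have hB₁ : ∀ x y, B₁ x y = B₀ (N₁.symm x) (N₁.symm y) := fun _ _ => rfl
  have hB₁' : IsInner B₁ := ⟨fun x y => by rw [hB₁, hB₁, hB₀.symm], fun x hx => by
    have : N₁.symm x = 0 := hB₀.nondeg _ fun y => by simpa [hB₁] using hx (N₁ y)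
    simpa using this⟩
  have hg : ∀ x y, g x y = N₁.symm (f' (N₂ x) (N₃ y)) := fun x y => by rw [← hN]; simp
  have hadj : ∀ B : W →+ W →+ ZMod p, IsInner B → ∃ N : V ≃+ W, ∀ w z,
      B₀ (N₁.symm w) z = B w (N z) := by
    intro B hB
    obtain ⟨R, hR⟩ := hB.exists_adjoint_equiv hB₀ N₁.symm
    exact ⟨R, fun w z => by rw [hB.symm, hR, hB₀.symm]⟩
  rcases hf' with rfl | rfl | ⟨B, hs, hn, ht⟩ | ⟨B, hs, hn, ht⟩ | ⟨k, ⟨B, hs, hn, ht⟩, rfl⟩ |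
    ⟨k, ⟨B, hs, hn, ht⟩, rfl⟩
  · exact ⟨B₁, hB₁', hW, ⟨1, ![N₂, N₃, N₁], fun x => by simp [triForm, hB₁, hg]⟩⟩
  · exact ⟨B₁, hB₁', hW, ⟨Equiv.swap 0 1, ![N₃, N₂, N₁], fun x => by
      simp [triForm, hB₁, hg, dualMul, Equiv.swap_apply_of_ne_of_ne]⟩⟩
  · obtain ⟨N, hNz⟩ := hadj B ⟨hs, hn⟩
    exact ⟨B, ⟨hs, hn⟩, hW, ⟨Equiv.swap 0 2, ![N, N₃, N₂], fun x => by
      simp [triForm, hg, Equiv.swap_apply_of_ne_of_ne, hNz, ht, hs (N₂ (x 0))]⟩⟩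
  · obtain ⟨N, hNz⟩ := hadj B ⟨hs, hn⟩
    exact ⟨B, ⟨hs, hn⟩, hW, ⟨Equiv.swap 0 2 * Equiv.swap 0 1, ![N₃, N, N₂], fun x => by
      simp [triForm, hg, Equiv.swap_apply_of_ne_of_ne, hNz, ht, dualMul, hs (N₂ (x 0))]⟩⟩
  · obtain ⟨N, hNz⟩ := hadj B ⟨hs, hn⟩
    exact ⟨B, ⟨hs, hn⟩, hW, ⟨Equiv.swap 0 1 * Equiv.swap 0 2, ![N, N₂, N₃], fun x => by
      simp [triForm, hg, Equiv.swap_apply_of_ne_of_ne, hNz, ht, dualMul, hs (N₃ (x 1))]⟩⟩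
  · obtain ⟨N, hNz⟩ := hadj B ⟨hs, hn⟩
    exact ⟨B, ⟨hs, hn⟩, hW, ⟨Equiv.swap 1 2, ![N₂, N, N₃], fun x => by
      simp [triForm, hg, Equiv.swap_apply_of_ne_of_ne, hNz, ht, dualMul, hs (N₃ (x 1))]⟩⟩

end Forms

/-! ## Derivations of the trilinear form of the new family -/

section Admissible

/-- The conditions on the parameters used below. -/
structure Admissible (p : ℕ) {L : Type*} [Field L] (σ : RingAut L) (α η : L) : Prop where
  two_ne : (2 : L) ≠ 0
  alpha_ne : α ≠ 0
  eta_ne : η ≠ 0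
  map_eta : σ η = η
  pow_ne : ∀ j : ℕ, 0 < j → j < 10 → σ ^ j ≠ 1
  eq_zero_of_neg : ∀ u, σ u = -u → u = 0
  eq_zero_of_cube_neg : ∀ u, (σ ^ 3) u = -u → u = 0
  card_fixed : Nat.card {x // σ x = x} ≤ p ^ 2
  not_twist : ∀ d, d ≠ 0 → σ d ≠ -η * d

/-- Coordinatewise multiplication by constants. -/
def diagMul {L : Type*} [Field L] (a b : L) : L × L →+ L × L :=
  AddMonoidHom.mk' (fun x => (a * x.1, b * x.2)) fun x y => by simp [mul_add]

theorem diagMul_apply {L : Type*} [Field L] (a b : L) (x : L × L) :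
    diagMul a b x = (a * x.1, b * x.2) := rfl

theorem diagMul_injective {L : Type*} [Field L] {a b c d : L} (h : diagMul a b = diagMul c d) :
    a = c ∧ b = d := by
  have := DFunLike.congr_fun h (1, 1)
  simpa [diagMul_apply] using this

theorem cube_apply_of_fixed {L : Type*} [Field L] {σ : RingAut L} {k : L} (hk : σ k = k) :
    (σ ^ 3) k = k := by
  change σ (σ (σ k)) = _
  simp only [hk]

theorem Admissible.not_fix_ringHom {p : ℕ} {L : Type*} [Field L] [Finite L] {σ : RingAut L}
    {α η : L} (hA : Admissible p σ α η) (θ : L →+* L) {j : ℕ} (h0 : 0 < j)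
    (hj : j < 10) (h : ∀ e, (σ ^ j) (θ e) = θ e) : False := by
  refine hA.pow_ne j h0 hj (RingEquiv.ext fun x => ?_)
  obtain ⟨e, rfl⟩ := Finite.injective_iff_surjective.1 θ.injective x
  exact h e

theorem Admissible.ringHom_eq {p : ℕ} {L : Type*} [Field L] [Finite L] {σ : RingAut L}
    {α η : L} (hA : Admissible p σ α η) {θ θ' : L →+* L}
    (h : ∀ e, σ (θ e - θ' e) = θ e - θ' e) : θ = θ' := by
  rcases ringHom_add_eq_add hA.two_ne (θ₁ := θ) (θ₂ := (σ : L →+* L).comp θ') (χ₁ := θ')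
    (χ₂ := (σ : L →+* L).comp θ) (fun e => by
      have := h e
      rw [map_sub] at this
      simp only [RingHom.comp_apply, RingHom.coe_coe]
      linear_combination -this) with h1 | h1
  · exact h1.1
  · exact (hA.not_fix_ringHom θ (j := 1) (by norm_num) (by norm_num) fun e =>
      (by rw [pow_one]; exact (DFunLike.congr_fun h1.1 e).symm)).elim

/-! ### Representations of `L` by derivations -/

/-- `F` is a unital ring homomorphism from `L` to the endomorphisms of `V`. -/
structure IsRep {L V : Type*} [Field L] [AddCommGroup V] (F : L → V →+ V) : Prop where
  add : ∀ a b x, F (a + b) x = F a x + F b x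
  mul : ∀ a b x, F (a * b) x = F a (F b x)
  one : ∀ x, F 1 x = x

theorem IsRep.conj {L V W : Type*} [Field L] [AddCommGroup V] [AddCommGroup W] {F : L → W →+ W}
    (hF : IsRep F) (N : V ≃+ W) :
    IsRep fun e => (N.symm : W →+ V).comp ((F e).comp (N : V →+ W)) where
  add a b x := by simp [hF.add]
  mul a b x := by simp [hF.mul]
  one x := by simp [hF.one]

theorem IsRep.exists_ringHom {L : Type*} [Field L] {F : L → L × L →+ L × L} (hF : IsRep F)
    {u v : L → L}
    (huv : ∀ e, F e = diagMul (u e) (v e)) :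
    ∃ θ₁ θ₂ : L →+* L, (∀ e, u e = θ₁ e) ∧ ∀ e, v e = θ₂ e := by
  have hadd := fun a b => hF.add a b (1, 1)
  have hmul := fun a b => hF.mul a b (1, 1)
  have hone := hF.one (1, 1)
  simp only [huv, diagMul_apply, mul_one, Prod.mk_add_mk, Prod.mk.injEq] at hadd hmul hone
  have hu0 : u 0 = 0 := by simpa using (hadd 0 0).1
  have hv0 : v 0 = 0 := by simpa using (hadd 0 0).2
  exact ⟨⟨⟨⟨u, hone.1⟩, fun a b => (hmul a b).1⟩, hu0, fun a b => (hadd a b).1⟩,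
    ⟨⟨⟨v, hone.2⟩, fun a b => (hmul a b).2⟩, hv0, fun a b => (hadd a b).2⟩,
    fun _ => rfl, fun _ => rfl⟩

variable {p : ℕ} [Fact p.Prime] {L : Type*} [Field L] [Algebra (ZMod p) L]

variable (p L) in
/-- The trace form on `L × L`. -/
noncomputable def prodTrace : L × L →+ L × L →+ ZMod p :=
  AddMonoidHom.mk' (fun x => AddMonoidHom.mk'
    (fun y => Algebra.trace (ZMod p) L (x.1 * y.1 + x.2 * y.2)) fun y z => by
      rw [← map_add]; congr 1; simp only [Prod.fst_add, Prod.snd_add]; ring) fun x y => by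
    ext z
    simp only [AddMonoidHom.mk'_apply, AddMonoidHom.add_apply]
    rw [← map_add]; congr 1; simp only [Prod.fst_add, Prod.snd_add]; ring

theorem prodTrace_apply (x y : L × L) :
    prodTrace p L x y = Algebra.trace (ZMod p) L (x.1 * y.1 + x.2 * y.2) := rfl

theorem prodTrace_diagMul (a b : L) (x y : L × L) :
    prodTrace p L (diagMul a b x) y = prodTrace p L x (diagMul a b y) := by
  simp only [prodTrace_apply, diagMul_apply]
  congr 1; ring

variable [Finite L]

theorem isInner_prodTrace : IsInner (prodTrace p L) where
  symm x y := by simp only [prodTrace_apply, mul_comm]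
  nondeg x hx := by
    have hnd := (traceForm_nondegenerate (ZMod p) L).1
    refine Prod.ext (hnd x.1 fun y => ?_) (hnd x.2 fun y => ?_)
    · simpa [prodTrace_apply] using hx (y, 0)
    · simpa [prodTrace_apply] using hx (0, y)

variable {σ : RingAut L} {α η : L}

theorem mem_derivs_newMul (hA : Admissible p σ α η) {D : Fin 3 → L × L →+ L × L} :
    D ∈ derivs (triForm (prodTrace p L) (newMul σ (σ ^ 3) α η)) ↔
      ∃ a b, σ (a - b) = a - b ∧ D 0 = diagMul a a ∧ D 1 = diagMul b b ∧
        D 2 = diagMul (-(a + σ b)) (-(a + (σ ^ 3) b)) := by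
  have hB := isInner_prodTrace (p := p) (L := L)
  constructor
  · intro h
    obtain ⟨C, hC, hD⟩ := exists_derivation_of_mem hB h
    obtain ⟨a, b, hab, h0, h1, h2⟩ := newMul_derivation p hA.alpha_ne hA.eta_ne hA.map_eta hA.pow_ne
      hA.eq_zero_of_neg hD
    refine ⟨a, b, hab, AddMonoidHom.ext h0, AddMonoidHom.ext h1, AddMonoidHom.ext fun y => ?_⟩
    have h2' : ∀ x, C x = diagMul (a + σ b) (a + (σ ^ 3) b) x := h2
    have h3 : -D 2 y = diagMul (a + σ b) (a + (σ ^ 3) b) y := hB.ext fun x => by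
      rw [hB.symm, hB.symm _ x, ← prodTrace_diagMul, ← h2', hC]
    rw [← neg_neg (D 2 y), h3]
    simp [diagMul_apply]
    constructor <;> ring
  · rintro ⟨a, b, hab, h0, h1, h2⟩
    have hτ : (σ ^ 3) (a - b) = a - b := by
      change σ (σ (σ (a - b))) = _
      simp only [hab]
    have hτη : (σ ^ 3).symm η = η := by
      rw [RingEquiv.symm_apply_eq]
      change η = σ (σ (σ η))
      simp [hA.map_eta]
    refine mem_derivs_triForm.2 fun x y z => ?_
    have h2' : D 2 z = -diagMul (a + σ b) (a + (σ ^ 3) b) z := by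
      rw [h2]; simp [diagMul_apply]; constructor <;> ring
    rw [h2', map_neg, ← prodTrace_diagMul, ← AddMonoidHom.add_apply, ← map_add, ← sub_eq_add_neg,
      ← AddMonoidHom.sub_apply, ← map_sub]
    convert AddMonoidHom.zero_apply (M := L × L) (N := ZMod p) z
    rw [← map_zero (prodTrace p L)]
    congr 1
    rw [h0, h1]
    rw [map_sub] at hab hτ
    simp only [newMul, diagMul_apply, map_mul, hτη, Prod.mk_add_mk, Prod.mk_sub_mk, Prod.mk_eq_zero]
    constructor
    · linear_combination (-η * σ x.2 * y.2 - α * η * σ x.1 * y.1) * hab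
    · linear_combination (σ ^ 3) x.1 * y.2 * hτ

theorem derivs_slot_zero (hA : Admissible p σ α η) {D : Fin 3 → L × L →+ L × L}
    (hD : D ∈ derivs (triForm (prodTrace p L) (newMul σ (σ ^ 3) α η))) {j : Fin 3} (hj : D j = 0) :
    ∃ k : Fin 3 → L, (∀ i, σ (k i) = k i) ∧ k 0 + k 1 + k 2 = 0 ∧
      ∀ i, D i = diagMul (k i) (k i) := by
  obtain ⟨a, b, hab, h0, h1, h2⟩ := (mem_derivs_newMul hA).1 hD
  have hz : (0 : L × L →+ L × L) = diagMul 0 0 := by ext x <;> simp [diagMul_apply]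
  rw [map_sub] at hab
  have hmain : σ b = b ∧ σ a = a := by
    fin_cases j
    · have h := h0.symm.trans (hj.trans hz)
      have ha := (diagMul_injective h).1
      rw [ha, map_zero] at hab
      exact ⟨by linear_combination -hab, by rw [ha, map_zero]⟩
    · have h := h1.symm.trans (hj.trans hz)
      have hb := (diagMul_injective h).1
      rw [hb, map_zero] at hab
      exact ⟨by rw [hb, map_zero], by linear_combination hab⟩
    · have h := h2.symm.trans (hj.trans hz)
      obtain ⟨h3, h4⟩ := diagMul_injective h
      change -(a + σ (σ (σ b))) = 0 at h4
      have h5 : σ (σ b) = b := σ.injective (by linear_combination h3 - h4)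
      have h6 := hA.eq_zero_of_neg (σ b - b) (by rw [map_sub, h5]; ring)
      have h7 : σ b = b := sub_eq_zero.1 h6
      exact ⟨h7, by linear_combination hab + h7⟩
  refine ⟨![a, b, -(a + b)], fun i => ?_, by simp, fun i => ?_⟩
  · fin_cases i
    · exact hmain.2
    · exact hmain.1
    · change σ (-(a + b)) = -(a + b)
      rw [map_neg, map_add, hmain.1, hmain.2]
  · fin_cases i
    · exact h0
    · exact h1
    · change D 2 = diagMul (-(a + b)) (-(a + b))
      rw [h2, cube_apply_of_fixed hmain.1, hmain.1]

theorem mem_derivs_of_fixed (hA : Admissible p σ α η) {k : Fin 3 → L} (hk : ∀ i, σ (k i) = k i)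
    (hsum : k 0 + k 1 + k 2 = 0) :
    (fun i => diagMul (k i) (k i)) ∈
      derivs (triForm (prodTrace p L) (newMul σ (σ ^ 3) α η)) := by
  refine (mem_derivs_newMul hA).2 ⟨k 0, k 1, by rw [map_sub, hk, hk], rfl, rfl, ?_⟩
  have : k 2 = -(k 0 + k 1) := by linear_combination hsum
  simp only [hk, cube_apply_of_fixed (hk 1), this]

/-- The last argument and another one cannot both carry a representation. -/
theorem not_isRep_two (hA : Admissible p σ α η) {D : L → Fin 3 → L × L →+ L × L}
    (hD : ∀ e, D e ∈ derivs (triForm (prodTrace p L) (newMul σ (σ ^ 3) α η))) {j : Fin 3}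
    (hj : j ≠ 2) (h1 : IsRep fun e => D e j) (h2 : IsRep fun e => D e 2) : False := by
  choose a b hab hD0 hD1 hD2 using fun e => (mem_derivs_newMul hA).1 (hD e)
  obtain ⟨ψ, ψ', hψ, -⟩ := h2.exists_ringHom hD2
  have hj' : j = 0 ∨ j = 1 := by omega
  rcases hj' with rfl | rfl
  · obtain ⟨θ, -, hθ, -⟩ := h1.exists_ringHom hD0
    have key : ∀ e, ψ e + θ e = ((σ * σ : RingAut L) : L →+* L).comp θ e
        + (σ : L →+* L).comp ψ e := by
      intro e
      have e1 := hψ e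
      have e2 := hab e
      rw [hθ] at e1 e2
      have e3 := congrArg σ e1
      have e4 := congrArg σ e2
      simp only [map_neg, map_add, map_sub, RingHom.comp_apply, RingHom.coe_coe,
        RingAut.mul_apply] at *
      linear_combination -e1 + e3 - e4
    rcases ringHom_add_eq_add hA.two_ne key with h | h
    · refine hA.not_fix_ringHom θ (j := 3) (by norm_num) (by norm_num) fun e => ?_
      have e1 := DFunLike.congr_fun h.1 e
      have e2 := DFunLike.congr_fun h.2 e
      change σ (σ (σ (θ e))) = _
      simp only [RingHom.comp_apply, RingHom.coe_coe, RingAut.mul_apply] at e1 e2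
      rw [← e1, ← e2]
    · refine hA.not_fix_ringHom θ (j := 2) (by norm_num) (by norm_num) fun e => ?_
      exact (DFunLike.congr_fun h.2 e).symm
  · obtain ⟨θ, -, hθ, -⟩ := h1.exists_ringHom hD1
    have key : ∀ e, ψ e + θ e = ((σ * σ : RingAut L) : L →+* L).comp θ e
        + (σ : L →+* L).comp ψ e := by
      intro e
      have e1 := hψ e
      have e2 := hab e
      rw [hθ] at e1 e2
      have e3 := congrArg σ e1
      have e4 := congrArg σ e2
      simp only [map_neg, map_add, map_sub, RingHom.comp_apply, RingHom.coe_coe,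
        RingAut.mul_apply] at *
      linear_combination -e1 + e3 + e2
    rcases ringHom_add_eq_add hA.two_ne key with h | h
    · refine hA.not_fix_ringHom θ (j := 3) (by norm_num) (by norm_num) fun e => ?_
      have e1 := DFunLike.congr_fun h.1 e
      have e2 := DFunLike.congr_fun h.2 e
      change σ (σ (σ (θ e))) = _
      simp only [RingHom.comp_apply, RingHom.coe_coe, RingAut.mul_apply] at e1 e2
      rw [← e1, ← e2]
    · refine hA.not_fix_ringHom θ (j := 2) (by norm_num) (by norm_num) fun e => ?_
      exact (DFunLike.congr_fun h.2 e).symm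

end Admissible

/-! ## Consequences of an equivalence with the new family -/

theorem SlotEquiv.conj_slot_zero {p : ℕ} {V W : Type*} [AddCommGroup V] [AddCommGroup W]
    {t : (Fin 3 → V) → ZMod p} {t' : (Fin 3 → W) → ZMod p} (E : SlotEquiv t t')
    {D : Fin 3 → W →+ W} {j : Fin 3} (hj : D j = 0) : E.conj D (E.perm j) = 0 := by
  ext x
  simp [SlotEquiv.conj_apply, hj]

theorem SlotEquiv.conj_congr {p : ℕ} {V W : Type*} [AddCommGroup V] [AddCommGroup W]
    {t : (Fin 3 → V) → ZMod p} {t' : (Fin 3 → W) → ZMod p} (E : SlotEquiv t t')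
    {D D' : Fin 3 → W →+ W} {j : Fin 3} (hj : D (E.perm.symm j) = D' (E.perm.symm j)) :
    E.conj D j = E.conj D' j := by
  ext x
  rw [SlotEquiv.conj_apply, SlotEquiv.conj_apply, hj]

section Consequences

variable {p : ℕ} [Fact p.Prime] {L : Type*} [Field L] [Algebra (ZMod p) L] [Finite L]
  {σ : RingAut L} {α η : L} {W : Type*} [AddCommGroup W] {B : W →+ W →+ ZMod p}
  {f : W → W → W}

/-- The derivation algebra of a multiplication equivalent to the new one is small. -/
theorem card_le_of_derivations [Finite W] (hA : Admissible p σ α η) (hB : IsInner B)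
    (E : SlotEquiv (triForm (prodTrace p L) (newMul σ (σ ^ 3) α η)) (triForm B f))
    {H : Type*} {X Y Z : H → W →+ W}
    (h : ∀ i x y, Z i (f x y) = f (X i x) y + f x (Y i y))
    (hinj : ∀ i j, X i = X j → Y i = Y j → i = j) : Nat.card H ≤ p ^ 2 * Nat.card L := by
  choose R hR hD using fun i => exists_mem_derivs hB (h i)
  choose a b hab h0 h1 h2 using fun i => (mem_derivs_newMul hA).1 (E.conj_mem (hD i))
  rw [mul_comm]
  refine le_trans ?_ (Nat.mul_le_mul_left (Nat.card L) hA.card_fixed)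
  rw [← Nat.card_prod]
  refine Nat.card_le_card_of_injective (fun i => ((a i, ⟨a i - b i, hab i⟩) : L × {x // σ x = x}))
    fun i j hij => ?_
  simp only [Prod.mk.injEq, Subtype.mk.injEq] at hij
  have ha := hij.1
  have hb : b i = b j := by linear_combination ha - hij.2
  have hc : E.conj ![X i, Y i, -R i] = E.conj ![X j, Y j, -R j] := by
    funext k
    fin_cases k
    · exact (h0 i).trans ((h0 j).trans (by rw [ha])).symm
    · exact (h1 i).trans ((h1 j).trans (by rw [hb])).symm
    · exact (h2 i).trans ((h2 j).trans (by rw [ha, hb])).symm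
  have hd := E.conj_injective hc
  exact hinj i j (congrFun hd 0) (congrFun hd 1)

theorem card_le_of_slot_zero (hA : Admissible p σ α η)
    (E : SlotEquiv (triForm (prodTrace p L) (newMul σ (σ ^ 3) α η)) (triForm B f))
    {H : Type*} {D : H → Fin 3 → W →+ W} (hD : ∀ i, D i ∈ derivs (triForm B f)) (j : Fin 3)
    (hj : ∀ i, D i j = 0) (hinj : Function.Injective D) : Nat.card H ≤ p ^ 2 := by
  choose k hk hsum hkD using fun i =>
    derivs_slot_zero hA (E.conj_mem (hD i)) (E.conj_slot_zero (hj i))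
  have hkj : ∀ i, k i (E.perm j) = 0 := fun i => by
    have := (hkD i (E.perm j)).symm.trans (E.conj_slot_zero (hj i))
    simpa [diagMul_apply] using DFunLike.congr_fun this (1, 1)
  obtain ⟨l, hl⟩ : ∃ l : Fin 3, ∀ m, m = l ∨ m = E.perm j ∨
      ∀ q : Fin 3 → L, q 0 + q 1 + q 2 = 0 → q (E.perm j) = 0 → q m = -q l := by
    generalize E.perm j = j'
    fin_cases j'
    · refine ⟨1, fun m => ?_⟩
      fin_cases m <;> simp
      intro q h1 h2; linear_combination h1 - h2
    · refine ⟨0, fun m => ?_⟩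
      fin_cases m <;> simp
      intro q h1 h2; linear_combination h1 - h2
    · refine ⟨0, fun m => ?_⟩
      fin_cases m <;> simp
      intro q h1 h2; linear_combination h1 - h2
  refine le_trans ?_ hA.card_fixed
  refine Nat.card_le_card_of_injective (fun i => (⟨k i l, hk i l⟩ : {x // σ x = x}))
    fun i i' hii => hinj (E.conj_injective (funext fun m => ?_))
  have hkl : k i l = k i' l := congrArg Subtype.val hii
  rw [hkD, hkD]
  rcases hl m with rfl | rfl | hm
  · rw [hkl]
  · rw [hkj, hkj]
  · rw [hm _ (hsum i) (hkj i), hm _ (hsum i') (hkj i'), hkl]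

theorem exists_central (hA : Admissible p σ α η)
    (E : SlotEquiv (triForm (prodTrace p L) (newMul σ (σ ^ 3) α η)) (triForm B f))
    {D : Fin 3 → W →+ W} (hD : D ∈ derivs (triForm B f)) {j i : Fin 3} (hj : D j = 0) (l : Fin 3)
    (hil : i ≠ l) : ∃ D' ∈ derivs (triForm B f), D' i = D i ∧ D' l = 0 := by
  obtain ⟨k, hk, hsum, hkD⟩ := derivs_slot_zero hA (E.conj_mem hD) (E.conj_slot_zero hj)
  obtain ⟨q, hq, hqs, hqi, hql⟩ : ∃ q : Fin 3 → L, (∀ m, σ (q m) = q m) ∧ q 0 + q 1 + q 2 = 0 ∧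
      q (E.perm i) = k (E.perm i) ∧ q (E.perm l) = 0 := by
    have hne : E.perm i ≠ E.perm l := fun h => hil (E.perm.injective h)
    generalize E.perm i = i' at *
    generalize E.perm l = l' at *
    have h1 : σ (-k i') = -k i' := by rw [map_neg, hk]
    fin_cases i' <;> fin_cases l' <;> first | exact absurd rfl hne | skip
    · exact ⟨![k 0, 0, -k 0], fun m => by fin_cases m <;> simp [hk], by simp, rfl, rfl⟩
    · exact ⟨![k 0, -k 0, 0], fun m => by fin_cases m <;> simp [hk], by simp, rfl, rfl⟩
    · exact ⟨![0, k 1, -k 1], fun m => by fin_cases m <;> simp [hk], by simp, rfl, rfl⟩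
    · exact ⟨![-k 1, k 1, 0], fun m => by fin_cases m <;> simp [hk], by simp, rfl, rfl⟩
    · exact ⟨![0, -k 2, k 2], fun m => by fin_cases m <;> simp [hk], by simp, rfl, rfl⟩
    · exact ⟨![-k 2, 0, k 2], fun m => by fin_cases m <;> simp [hk], by simp, rfl, rfl⟩
  have hmem := E.symm.conj_mem (mem_derivs_of_fixed hA hq hqs)
  have hDD := E.conj_symm_conj D
  refine ⟨_, hmem, ?_, ?_⟩
  · rw [← congrFun hDD i]
    refine E.symm.conj_congr ?_
    change diagMul (q (E.perm i)) (q (E.perm i)) = E.conj D (E.perm i)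
    rw [hkD, hqi]
  · have h0 : E.symm.conj (0 : Fin 3 → L × L →+ L × L) l = 0 := by
      ext x
      simp [SlotEquiv.conj_apply]
    rw [← h0]
    refine E.symm.conj_congr ?_
    change diagMul (q (E.perm l)) (q (E.perm l)) = 0
    rw [hql]
    ext x <;> simp [diagMul_apply]

/-- Left multiplications from the nucleus. -/
theorem card_le_of_left_nucleus [Finite W] (hA : Admissible p σ α η) (hB : IsInner B)
    (E : SlotEquiv (triForm (prodTrace p L) (newMul σ (σ ^ 3) α η)) (triForm B f))
    (hf0 : ∀ x, f x 0 = 0) {H : Type*} {X Z : H → W →+ W}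
    (h : ∀ i x y, Z i (f x y) = f (X i x) y) (hinj : Function.Injective X) :
    Nat.card H ≤ p ^ 2 := by
  choose R hR hD using fun i => exists_mem_derivs hB (A := X i) (A' := 0) (C := Z i)
    (f := f) fun x y => by rw [h, AddMonoidHom.zero_apply, hf0, add_zero]
  exact card_le_of_slot_zero hA E hD 1 (fun _ => rfl) fun i j hij => hinj (congrFun hij 0)

theorem card_le_of_right_nucleus [Finite W] (hA : Admissible p σ α η) (hB : IsInner B)
    (E : SlotEquiv (triForm (prodTrace p L) (newMul σ (σ ^ 3) α η)) (triForm B f))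
    (hf0 : ∀ y, f 0 y = 0) {H : Type*} {Y Z : H → W →+ W}
    (h : ∀ i x y, Z i (f x y) = f x (Y i y)) (hinj : Function.Injective Y) :
    Nat.card H ≤ p ^ 2 := by
  choose R hR hD using fun i => exists_mem_derivs hB (A := 0) (A' := Y i) (C := Z i)
    (f := f) fun x y => by rw [h, AddMonoidHom.zero_apply, hf0, zero_add]
  exact card_le_of_slot_zero hA E hD 0 (fun _ => rfl) fun i j hij => hinj (congrFun hij 1)

theorem card_le_of_middle_nucleus (hA : Admissible p σ α η)
    (E : SlotEquiv (triForm (prodTrace p L) (newMul σ (σ ^ 3) α η)) (triForm B f))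
    {H : Type*} {X Y : H → W →+ W}
    (h : ∀ i x y, f (X i x) y + f x (Y i y) = 0) (hinj : Function.Injective X) :
    Nat.card H ≤ p ^ 2 := by
  have hD : ∀ i, ![X i, Y i, 0] ∈ derivs (triForm B f) := fun i =>
    mem_derivs_triForm.2 fun x y z => by
      change B (f (X i x) y) z + B (f x (Y i y)) z + B (f x y) ((0 : W →+ W) z) = 0
      rw [← AddMonoidHom.add_apply, ← map_add, h]
      simp
  exact card_le_of_slot_zero hA E hD 2 (fun _ => rfl) fun i j hij => hinj (congrFun hij 0)

/-- Elements of the nuclei are central. -/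
theorem exists_middle_of_left [Finite W] (hA : Admissible p σ α η) (hB : IsInner B)
    (E : SlotEquiv (triForm (prodTrace p L) (newMul σ (σ ^ 3) α η)) (triForm B f))
    (hf0 : ∀ x, f x 0 = 0) (hfn : ∀ x y, f x (-y) = -f x y) {X Z : W →+ W}
    (h : ∀ x y, Z (f x y) = f (X x) y) : ∃ Y : W →+ W, ∀ x y, f (X x) y = f x (Y y) := by
  obtain ⟨R, -, hD⟩ := exists_mem_derivs hB (A := X) (A' := 0) (C := Z)
    (f := f) fun x y => by rw [h, AddMonoidHom.zero_apply, hf0, add_zero]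
  obtain ⟨D', hD', h0, h2⟩ := exists_central hA E hD (j := 1) (i := 0) rfl 2 (by decide)
  refine ⟨-D' 1, fun x y => hB.ext fun z => ?_⟩
  have := mem_derivs_triForm.1 hD' x y z
  rw [h0, h2] at this
  rw [AddMonoidHom.neg_apply, hfn, map_neg, AddMonoidHom.neg_apply, eq_neg_iff_add_eq_zero]
  simpa using this

theorem exists_middle_of_right [Finite W] (hA : Admissible p σ α η) (hB : IsInner B)
    (E : SlotEquiv (triForm (prodTrace p L) (newMul σ (σ ^ 3) α η)) (triForm B f))
    (hf0 : ∀ y, f 0 y = 0) (hfn : ∀ x y, f (-x) y = -f x y) {Y Z : W →+ W}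
    (h : ∀ x y, Z (f x y) = f x (Y y)) : ∃ X : W →+ W, ∀ x y, f x (Y y) = f (X x) y := by
  obtain ⟨R, -, hD⟩ := exists_mem_derivs hB (A := 0) (A' := Y) (C := Z)
    (f := f) fun x y => by rw [h, AddMonoidHom.zero_apply, hf0, zero_add]
  obtain ⟨D', hD', h1, h2⟩ := exists_central hA E hD (j := 0) (i := 1) rfl 2 (by decide)
  refine ⟨-D' 0, fun x y => hB.ext fun z => ?_⟩
  have := mem_derivs_triForm.1 hD' x y z
  rw [h1, h2] at this
  rw [AddMonoidHom.neg_apply, hfn, map_neg, AddMonoidHom.neg_apply, eq_neg_iff_add_eq_zero,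
    add_comm]
  simpa using this

/-- If the first two arguments carry representations, the last arguments correspond. -/
theorem perm_symm_two (hA : Admissible p σ α η) {t : (Fin 3 → W) → ZMod p}
    (E : SlotEquiv (triForm (prodTrace p L) (newMul σ (σ ^ 3) α η)) t)
    {D : L → Fin 3 → W →+ W} (hD : ∀ e, D e ∈ derivs t) (h0 : IsRep fun e => D e 0)
    (h1 : IsRep fun e => D e 1) : E.perm.symm 2 = 2 := by
  by_contra hne
  have hrep : ∀ j, E.perm.symm j ≠ 2 → IsRep fun e => E.conj (D e) j := by
    intro j hj
    have : IsRep fun e => D e (E.perm.symm j) := by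
      have : E.perm.symm j = 0 ∨ E.perm.symm j = 1 := by omega
      rcases this with h | h <;> rw [h] <;> assumption
    exact this.conj (E.N (E.perm.symm j))
  obtain ⟨j, hj2, hj⟩ : ∃ j : Fin 3, j ≠ 2 ∧ E.perm.symm j ≠ 2 := by
    by_cases h : E.perm.symm 0 = 2
    · refine ⟨1, by decide, fun h' => ?_⟩
      exact absurd (E.perm.symm.injective (h.trans h'.symm)) (by decide)
    · exact ⟨0, by decide, h⟩
  exact not_isRep_two hA (fun e => E.conj_mem (hD e)) hj2 (hrep j hj) (hrep 2 hne)

/-- The shape of the transported family. -/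
theorem exists_torus (hA : Admissible p σ α η) {t : (Fin 3 → W) → ZMod p}
    (E : SlotEquiv (triForm (prodTrace p L) (newMul σ (σ ^ 3) α η)) t)
    {D : L → Fin 3 → W →+ W} (hD : ∀ e, D e ∈ derivs t) (h0 : IsRep fun e => D e 0)
    (h1 : IsRep fun e => D e 1) : ∃ θ : L →+* L, ∀ e,
      E.conj (D e) 2 = diagMul (-(θ e + σ (θ e))) (-(θ e + (σ ^ 3) (θ e))) := by
  have h2 := perm_symm_two hA E hD h0 h1
  have hrep : ∀ j, j ≠ 2 → IsRep fun e => E.conj (D e) j := by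
    intro j hj
    have : IsRep fun e => D e (E.perm.symm j) := by
      have hj' : E.perm.symm j ≠ 2 := fun h => hj (E.perm.symm.injective (h.trans h2.symm))
      have : E.perm.symm j = 0 ∨ E.perm.symm j = 1 := by omega
      rcases this with h | h <;> rw [h] <;> assumption
    exact this.conj (E.N (E.perm.symm j))
  choose a b hab hD0 hD1 hD2 using fun e => (mem_derivs_newMul hA).1 (E.conj_mem (hD e))
  obtain ⟨θ, -, hθ, -⟩ := (hrep 0 (by decide)).exists_ringHom hD0
  obtain ⟨θ', -, hθ', -⟩ := (hrep 1 (by decide)).exists_ringHom hD1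
  have := hA.ringHom_eq (θ := θ) (θ' := θ') fun e => by rw [← hθ, ← hθ', hab]
  subst this
  exact ⟨θ, fun e => by rw [hD2, hθ, hθ']⟩

end Consequences

section Torus

variable {L : Type*} [Field L]

theorem eigen_ratio (p : ℕ) [Fact p.Prime] [Algebra (ZMod p) L] [Finite L] (h2 : (2 : L) ≠ 0)
    {ρ μ ν : RingAut L} (hρ : ∀ u, ρ u = -u → u = 0) {θ : L →+* L} {f : L →+ L} (hf1 : f 1 ≠ 0)
    (h : ∀ e z, f ((μ e + ν e) * z) = (θ e + ρ (θ e)) * f z) : ν = ρ * μ ∨ μ = ρ * ν := by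
  have hinj : Function.Injective fun e => μ e + ν e := by
    intro x y hxy
    have h1 : μ (x - y) + ν (x - y) = 0 := by
      simp only [map_sub] at hxy ⊢
      linear_combination hxy
    have h3 := h (x - y) 1
    rw [h1, zero_mul, map_zero] at h3
    have h4 := (mul_eq_zero.1 h3.symm).resolve_right hf1
    have h5 := hρ (θ (x - y)) (by linear_combination h4)
    exact sub_eq_zero.1 ((map_eq_zero θ).1 h5)
  have hsurj := Finite.injective_iff_surjective.1 hinj
  let χ : L →+* L :=
    { toFun := fun z => f z / f 1
      map_one' := div_self hf1
      map_zero' := by simp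
      map_add' := fun x y => by rw [map_add, add_div]
      map_mul' := fun x y => by
        obtain ⟨e, rfl⟩ := hsurj x
        have h3 := h e y
        have h4 := h e 1
        rw [mul_one] at h4
        simp only [h3, h4]
        field_simp }
  have hχ : ∀ z, χ z = f z / f 1 := fun _ => rfl
  have hsum : ∀ e, χ (μ e) + χ (ν e) = θ e + ρ (θ e) := by
    intro e
    have h4 := h e 1
    rw [mul_one, map_add] at h4
    rw [hχ, hχ, ← add_div, h4]
    field_simp
  let χ' : RingAut L := RingEquiv.ofBijective χ (Finite.injective_iff_bijective.1 χ.injective)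
  have hχ' : ∀ z, χ z = χ' z := fun _ => rfl
  have hcomm := ringAut_mul_comm p ρ χ'
  have hcomm' : ∀ z, ρ (χ z) = χ (ρ z) := fun z => DFunLike.congr_fun hcomm z
  rcases ringHom_add_eq_add h2 (θ₁ := χ.comp (μ : L →+* L)) (θ₂ := χ.comp (ν : L →+* L))
    (χ₁ := θ) (χ₂ := (ρ : L →+* L).comp θ) hsum with ⟨h3, h4⟩ | ⟨h3, h4⟩
  · left
    ext e
    apply χ.injective
    have e3 := DFunLike.congr_fun h3 e
    have e4 := DFunLike.congr_fun h4 e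
    simp only [RingHom.comp_apply, RingHom.coe_coe] at e3 e4
    rw [e4, RingAut.mul_apply, ← hcomm', e3]
  · right
    ext e
    apply χ.injective
    have e3 := DFunLike.congr_fun h3 e
    have e4 := DFunLike.congr_fun h4 e
    simp only [RingHom.comp_apply, RingHom.coe_coe] at e3 e4
    rw [e3, RingAut.mul_apply, ← hcomm', e4]

variable {p : ℕ} [Fact p.Prime] [Algebra (ZMod p) L] [Finite L]
  {σ : RingAut L} {α η : L} {B : L × L →+ L × L →+ ZMod p} {f : L × L → L × L → L × L}

/-- The weights of a torus acting on an equivalent multiplication. -/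
theorem torus_weights (hA : Admissible p σ α η) (hB : IsInner B)
    (E : SlotEquiv (triForm (prodTrace p L) (newMul σ (σ ^ 3) α η)) (triForm B f))
    {X : L → L × L →+ L × L} (hX : IsRep X) {μ₁ ν₁ μ₂ ν₂ : RingAut L}
    (h : ∀ e x y, diagMul (μ₁ e + ν₁ e) (μ₂ e + ν₂ e) (f x y) = f (X e x) y + f x (X e y)) :
    (∃ ρ, (ρ = σ ∨ ρ = σ ^ 3) ∧ (ν₁ = ρ * μ₁ ∨ μ₁ = ρ * ν₁)) ∧
    ∃ ρ, (ρ = σ ∨ ρ = σ ^ 3) ∧ (ν₂ = ρ * μ₂ ∨ μ₂ = ρ * ν₂) := by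
  choose R hR hD using fun e => exists_mem_derivs hB (h e)
  obtain ⟨θ, hθ⟩ := exists_torus hA E hD hX hX
  have hp2 := perm_symm_two hA E hD hX hX
  have hB₀ := isInner_prodTrace (p := p) (L := L)
  obtain ⟨Q, hQ⟩ := hB₀.exists_adjoint_equiv hB (E.N 2)
  have hRN : ∀ e x, R e (E.N 2 x) = E.N 2 (diagMul (θ e + σ (θ e)) (θ e + (σ ^ 3) (θ e)) x) := by
    intro e x
    have h1 := DFunLike.congr_fun (hθ e) x
    rw [SlotEquiv.conj_apply, hp2, AddEquiv.symm_apply_eq] at h1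
    change -(R e (E.N 2 x)) = _ at h1
    rw [← neg_neg (R e _), h1, ← map_neg]
    congr 1
    simp only [diagMul_apply, Prod.neg_mk, neg_mul, neg_neg]
  have hQC : ∀ e w, Q (diagMul (μ₁ e + ν₁ e) (μ₂ e + ν₂ e) w) =
      diagMul (θ e + σ (θ e)) (θ e + (σ ^ 3) (θ e)) (Q w) := by
    intro e w
    refine hB₀.ext fun v => ?_
    rw [hQ, prodTrace_diagMul, hQ, ← hRN, hB.symm, ← hR, hB.symm]
  have key : ∀ (ι : L →+ L × L) (μ ν : RingAut L), ι 1 ≠ 0 →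
      (∀ e z, diagMul (μ₁ e + ν₁ e) (μ₂ e + ν₂ e) (ι z) = ι ((μ e + ν e) * z)) →
      ∃ ρ, (ρ = σ ∨ ρ = σ ^ 3) ∧ (ν = ρ * μ ∨ μ = ρ * ν) := by
    intro ι μ ν hι hιe
    have hne : Q (ι 1) ≠ 0 := by simpa using hι
    by_cases h1 : (Q (ι 1)).1 = 0
    · have h3 : (Q (ι 1)).2 ≠ 0 := fun h3 => hne (Prod.ext h1 h3)
      refine ⟨σ ^ 3, Or.inr rfl, eigen_ratio p hA.two_ne hA.eq_zero_of_cube_neg (θ := θ)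
        (f := (AddMonoidHom.snd L L).comp ((Q : L × L →+ L × L).comp ι)) h3 fun e z => ?_⟩
      change (Q (ι _)).2 = _
      rw [← hιe, hQC]
      rfl
    · refine ⟨σ, Or.inl rfl, eigen_ratio p hA.two_ne hA.eq_zero_of_neg (θ := θ)
        (f := (AddMonoidHom.fst L L).comp ((Q : L × L →+ L × L).comp ι)) h1 fun e z => ?_⟩
      change (Q (ι _)).1 = _
      rw [← hιe, hQC]
      rfl
  exact ⟨key (AddMonoidHom.inl L L) _ _ (by simp) fun e z => by simp [diagMul_apply],
    key (AddMonoidHom.inr L L) _ _ (by simp) fun e z => by simp [diagMul_apply]⟩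

end Torus

section Commutative

variable {p : ℕ} [Fact p.Prime] {L : Type*} [Field L] [Algebra (ZMod p) L] [Finite L]
  {σ : RingAut L} {α η : L} {W : Type*} [AddCommGroup W]

/-- The new multiplication has no symmetry exchanging the factors. -/
theorem newMul_not_symmetric (hA : Admissible p σ α η) (P : L × L ≃+ L × L)
    (h : ∀ x y, newMul σ (σ ^ 3) α η x y = newMul σ (σ ^ 3) α η (P.symm y) (P x)) : False := by
  have hτη : (σ ^ 3).symm η = η := by
    rw [RingEquiv.symm_apply_eq]
    exact (cube_apply_of_fixed hA.map_eta).symm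
  have hC : ∀ e x y, diagMul (e + σ e) (e + (σ ^ 3) e) (newMul σ (σ ^ 3) α η x y) =
      newMul σ (σ ^ 3) α η (diagMul e e x) y + newMul σ (σ ^ 3) α η x (diagMul e e y) := by
    intro e x y
    simp only [newMul, diagMul_apply, map_mul, hτη, Prod.mk_add_mk, Prod.mk.injEq]
    constructor <;> ring
  let X : L → L × L →+ L × L := fun e =>
    (P.symm : L × L →+ L × L).comp ((diagMul e e).comp (P : L × L →+ L × L))
  let Y : L → L × L →+ L × L := fun e =>
    (P : L × L →+ L × L).comp ((diagMul e e).comp (P.symm : L × L →+ L × L))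
  have hX : ∀ e x, X e x = P.symm (diagMul e e (P x)) := fun _ _ => rfl
  have hY : ∀ e x, Y e x = P (diagMul e e (P.symm x)) := fun _ _ => rfl
  have hder : ∀ e x y, diagMul (e + σ e) (e + (σ ^ 3) e) (newMul σ (σ ^ 3) α η x y) =
      newMul σ (σ ^ 3) α η (X e x) y + newMul σ (σ ^ 3) α η x (Y e y) := by
    intro e x y
    rw [h x y, hC, h (X e x) y, h x (Y e y), hX, hY, add_comm]
    simp
  choose a b hab hXa hYb hZ using fun e => newMul_derivation p hA.alpha_ne hA.eta_ne hA.map_eta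
    hA.pow_ne hA.eq_zero_of_neg (hder e)
  have hrepX : IsRep X := IsRep.conj (F := fun e : L => diagMul e e)
    ⟨fun a b x => by simp [diagMul_apply, add_mul], fun a b x => by simp [diagMul_apply, mul_assoc],
      fun x => by simp [diagMul_apply]⟩ P
  have hrepY : IsRep Y := IsRep.conj (F := fun e : L => diagMul e e)
    ⟨fun a b x => by simp [diagMul_apply, add_mul], fun a b x => by simp [diagMul_apply, mul_assoc],
      fun x => by simp [diagMul_apply]⟩ P.symm
  obtain ⟨θ', -, hθ', -⟩ := hrepX.exists_ringHom (u := a) (v := a) fun e => AddMonoidHom.ext (hXa e)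
  obtain ⟨θ, -, hθ, -⟩ := hrepY.exists_ringHom (u := b) (v := b) fun e => AddMonoidHom.ext (hYb e)
  have hσ1 : ¬ ∀ e, σ e = e := fun hcon => hA.pow_ne 1 (by norm_num) (by norm_num)
    (RingEquiv.ext fun e => by rw [pow_one]; exact hcon e)
  have hlin : ∀ e, a e = e := by
    have h1 : ∀ e, RingHom.id L e + (σ : L →+* L) e = θ' e + (σ : L →+* L).comp θ e := by
      intro e
      have := hZ e (1, 1)
      simp only [diagMul_apply, mul_one, Prod.mk.injEq] at this
      rw [← hθ', RingHom.comp_apply, ← hθ]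
      exact this.1
    have h2 : ∀ e, RingHom.id L e + ((σ ^ 3 : RingAut L) : L →+* L) e =
        θ' e + ((σ ^ 3 : RingAut L) : L →+* L).comp θ e := by
      intro e
      have := hZ e (1, 1)
      simp only [diagMul_apply, mul_one, Prod.mk.injEq] at this
      rw [← hθ', RingHom.comp_apply, ← hθ]
      exact this.2
    intro e
    rw [hθ']
    rcases ringHom_add_eq_add hA.two_ne h1 with ⟨h3, -⟩ | ⟨-, h3⟩
    · exact (DFunLike.congr_fun h3 e).symm
    rcases ringHom_add_eq_add hA.two_ne h2 with ⟨h4, -⟩ | ⟨-, h4⟩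
    · exact (DFunLike.congr_fun h4 e).symm
    · refine absurd (fun e => ?_) (hA.pow_ne 2 (by norm_num) (by norm_num) ∘ RingEquiv.ext)
      apply σ.injective
      have := DFunLike.congr_fun (h3.trans h4.symm) e
      change σ (σ (σ e)) = σ e
      exact this.symm
  have hP : ∀ e x, P (e * x.1, e * x.2) = (e * (P x).1, e * (P x).2) := by
    intro e x
    have h1 := hXa e x
    rw [hX, hlin, AddEquiv.symm_apply_eq] at h1
    exact h1.symm
  have hsym : ∀ x y, newMul σ (σ ^ 3) α η x (P y) = newMul σ (σ ^ 3) α η y (P x) := fun x y => by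
    rw [h x (P y), AddEquiv.symm_apply_apply]
  obtain ⟨z, hz⟩ : ∃ z, σ z ≠ z := by by_contra hcon; push Not at hcon; exact hσ1 hcon
  obtain ⟨w, hw⟩ : ∃ w, (σ ^ 3) w ≠ w := by
    by_contra hcon
    push Not at hcon
    exact hA.pow_ne 3 (by norm_num) (by norm_num) (RingEquiv.ext hcon)
  have hP0 : ∀ e, P (e, 0) = (e * (P (1, 0)).1, e * (P (1, 0)).2) := fun e => by
    simpa using hP e (1, 0)
  have hP1 : ∀ e, P (0, e) = (e * (P (0, 1)).1, e * (P (0, 1)).2) := fun e => by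
    simpa using hP e (0, 1)
  have hc : (P (1, 0)).2 = 0 := by
    have h1 := congrArg Prod.snd (hsym (1, 0) (w, 0))
    rw [hP0 w] at h1
    simp only [newMul, map_one, one_mul, zero_mul, add_zero] at h1
    have h3 : ((σ ^ 3) w - w) * (P (1, 0)).2 = 0 := by linear_combination -h1
    exact (mul_eq_zero.1 h3).resolve_left (sub_ne_zero.2 hw)
  have hd : (P (0, 1)).2 = (σ ^ 3) (P (1, 0)).1 := by
    have h1 := congrArg Prod.snd (hsym (1, 0) (0, 1))
    simpa [newMul] using h1
  have hd0 : (P (0, 1)).2 = 0 := by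
    have h1 := congrArg Prod.fst (hsym (0, 1) (0, z))
    rw [hP1 z] at h1
    simp only [newMul, map_one, map_zero, map_mul, one_mul, mul_one, zero_mul, mul_zero,
      sub_zero, add_zero] at h1
    have h3 : (σ (P (0, 1)).2 + η * (P (0, 1)).2) * (σ z - z) = 0 := by linear_combination h1
    have h4 := (mul_eq_zero.1 h3).resolve_right (sub_ne_zero.2 hz)
    by_contra hne
    exact hA.not_twist _ hne (by linear_combination h4)
  have ha0 : (P (1, 0)).1 = 0 := by
    rw [hd0] at hd
    exact (map_eq_zero _).1 hd.symm
  have : P (1, 0) = 0 := Prod.ext ha0 hc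
  simp at this

def SlotEquiv.trans {p : ℕ} {U V W : Type*} [AddCommGroup U] [AddCommGroup V] [AddCommGroup W]
    {t : (Fin 3 → U) → ZMod p} {t' : (Fin 3 → V) → ZMod p} {t'' : (Fin 3 → W) → ZMod p}
    (E : SlotEquiv t t') (E' : SlotEquiv t' t'') : SlotEquiv t t'' where
  perm := E.perm * E'.perm
  N i := (E.N (E'.perm i)).trans (E'.N i)
  eq x := by rw [E.eq, E'.eq]; rfl

/-- A multiplication equivalent to the new one is not commutative. -/
theorem not_commutative (hA : Admissible p σ α η) {B : W →+ W →+ ZMod p} {f : W → W → W}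
    (E : SlotEquiv (triForm (prodTrace p L) (newMul σ (σ ^ 3) α η)) (triForm B f))
    (hf : ∀ x y, f x y = f y x) : False := by
  let S : SlotEquiv (triForm B f) (triForm B f) :=
    ⟨Equiv.swap 0 1, fun _ => AddEquiv.refl W, fun x => by
      simp [triForm, hf (x 0), Equiv.swap_apply_of_ne_of_ne]⟩
  let T := E.trans (S.trans E.symm)
  let D : L → Fin 3 → L × L →+ L × L := fun e =>
    ![diagMul e e, diagMul e e, diagMul (-(e + σ e)) (-(e + (σ ^ 3) e))]
  have hD : ∀ e, D e ∈ derivs (triForm (prodTrace p L) (newMul σ (σ ^ 3) α η)) := fun e =>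
    (mem_derivs_newMul hA).2 ⟨e, e, by simp, rfl, rfl, rfl⟩
  have hrep : IsRep fun e : L => diagMul e e :=
    ⟨fun a b x => by simp [diagMul_apply, add_mul], fun a b x => by simp [diagMul_apply, mul_assoc],
      fun x => by simp [diagMul_apply]⟩
  have hT := perm_symm_two hA T hD hrep hrep
  have hE2 : E.perm.symm 2 = 2 := by
    have h1 : T.perm.symm 2 = E.perm (Equiv.swap 0 1 (E.perm.symm 2)) := rfl
    rw [h1, ← Equiv.eq_symm_apply] at hT
    generalize E.perm.symm 2 = j at hT
    revert hT
    revert j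
    decide
  have hE2' : E.perm 2 = 2 := by rw [← hE2, Equiv.apply_symm_apply, hE2]
  have hcases : (E.perm 0 = 0 ∧ E.perm 1 = 1) ∨ (E.perm 0 = 1 ∧ E.perm 1 = 0) := by
    have h01 : E.perm 0 ≠ E.perm 1 := fun h => absurd (E.perm.injective h) (by decide)
    have h02 : E.perm 0 ≠ E.perm 2 := fun h => absurd (E.perm.injective h) (by decide)
    have h12 : E.perm 1 ≠ E.perm 2 := fun h => absurd (E.perm.injective h) (by decide)
    rw [hE2'] at h02 h12
    omega
  have hB₀ := isInner_prodTrace (p := p) (L := L)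
  have heq : ∀ x y z, prodTrace p L (newMul σ (σ ^ 3) α η x y) z =
      B (f (E.N 0 (![x, y, z] (E.perm 0))) (E.N 1 (![x, y, z] (E.perm 1)))) (E.N 2 z) := by
    intro x y z
    have := E.eq ![x, y, z]
    simp only [triForm, hE2'] at this
    exact this
  rcases hcases with ⟨h0, h1⟩ | ⟨h0, h1⟩
  · refine newMul_not_symmetric hA ((E.N 0).trans (E.N 1).symm) fun x y => hB₀.ext fun z => ?_
    rw [heq, heq, h0, h1, hf]
    simp
  · refine newMul_not_symmetric hA ((E.N 1).trans (E.N 0).symm) fun x y => hB₀.ext fun z => ?_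
    rw [heq, heq, h0, h1, hf]
    simp

end Commutative

/-! ## The known families -/

section General

variable {V : Type*} [AddCommGroup V] {f : V → V → V}

theorem IsPresemifield.mul_zero (hf : IsPresemifield f) (x : V) : f x 0 = 0 := by
  simpa using hf.mul_add x 0 0

theorem IsPresemifield.zero_mul (hf : IsPresemifield f) (y : V) : f 0 y = 0 := by
  simpa using hf.add_mul 0 0 y

theorem IsPresemifield.mul_neg (hf : IsPresemifield f) (x y : V) : f x (-y) = -f x y := by
  rw [eq_neg_iff_add_eq_zero, ← hf.mul_add, neg_add_cancel, hf.mul_zero]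

theorem IsPresemifield.neg_mul (hf : IsPresemifield f) (x y : V) : f (-x) y = -f x y := by
  rw [eq_neg_iff_add_eq_zero, ← hf.add_mul, neg_add_cancel, hf.zero_mul]

/-- Left multiplication. -/
def IsPresemifield.left (hf : IsPresemifield f) (x : V) : V →+ V :=
  AddMonoidHom.mk' (f x) (hf.mul_add x)

/-- Right multiplication. -/
def IsPresemifield.right (hf : IsPresemifield f) (y : V) : V →+ V :=
  AddMonoidHom.mk' (fun x => f x y) fun x z => hf.add_mul x z y

theorem card_le_card_ker_mul {M N : Type*} [AddCommGroup M] [AddCommGroup N] [Finite M] [Finite N]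
    (φ : M →+ N) : Nat.card M ≤ Nat.card φ.ker * Nat.card N := by
  rw [AddSubgroup.card_eq_card_quotient_mul_card_addSubgroup φ.ker, mul_comm]
  refine Nat.mul_le_mul_left _ ?_
  rw [Nat.card_congr (QuotientAddGroup.quotientKerEquivRange φ).toEquiv]
  exact Nat.card_le_card_of_injective _ Subtype.val_injective

end General

theorem card_eq_card_fixed_pow {L : Type*} [Field L] (p : ℕ) [Fact p.Prime] [Algebra (ZMod p) L]
    [Finite L] (s : RingAut L) : Nat.card L = Nat.card {x // s x = x} ^ orderOf s := by
  let g := ringAutEquivGal p s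
  let F := IntermediateField.fixedField (Subgroup.zpowers g)
  have h1 : Nat.card F = Nat.card {x // s x = x} := by
    refine Nat.card_congr (Equiv.subtypeEquivRight fun x => ?_)
    rw [IntermediateField.mem_fixedField_iff]
    constructor
    · intro h
      exact h g (Subgroup.mem_zpowers g)
    · intro h k hk
      have hs : g ∈ MulAction.stabilizer (Gal(L/ZMod p)) x := h
      exact (Subgroup.zpowers_le.2 hs) hk
  rw [← h1, Module.natCard_eq_pow_finrank (K := F) (V := L),
    IntermediateField.finrank_fixedField_eq_card, Nat.card_zpowers]
  congr 1
  exact (MulEquiv.orderOf_eq (ringAutEquivGal p) s)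

section Families

variable {p : ℕ} [Fact p.Prime] {L : Type*} [Field L] [Algebra (ZMod p) L] [Finite L]
  {σ : RingAut L} {α η : L}

theorem false_of_derivations (hA : Admissible p σ α η) (hL : p ^ 2 < Nat.card L)
    {W : Type*} [AddCommGroup W] [Finite W] {B : W →+ W →+ ZMod p} {f : W → W → W}
    (hB : IsInner B)
    (E : SlotEquiv (triForm (prodTrace p L) (newMul σ (σ ^ 3) α η)) (triForm B f))
    {H : Type*} (hH : Nat.card L * Nat.card L ≤ Nat.card H) {X Y Z : H → W →+ W}
    (h : ∀ i x y, Z i (f x y) = f (X i x) y + f x (Y i y))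
    (hinj : ∀ i j, X i = X j → Y i = Y j → i = j) : False := by
  have h1 := hH.trans (card_le_of_derivations hA hB E h hinj)
  have h2 := Nat.le_of_mul_le_mul_right h1 Nat.card_pos
  omega

theorem false_of_largeNucleus (hA : Admissible p σ α η) (hL : p ^ 2 < Nat.card L)
    {W : Type*} [AddCommGroup W] [Finite W] {B : W →+ W →+ ZMod p} {f : W → W → W}
    (hB : IsInner B)
    (E : SlotEquiv (triForm (prodTrace p L) (newMul σ (σ ^ 3) α η)) (triForm B f))
    (hf : IsSemifield f) (hnuc : Nat.card L ≤ Nat.card (leftNucleus f) ∨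
      Nat.card L ≤ Nat.card (middleNucleus f) ∨ Nat.card L ≤ Nat.card (rightNucleus f)) :
    False := by
  have hp := hf.toIsPresemifield
  obtain ⟨e, he⟩ := hf.exists_one
  have hl : Function.Injective hp.left := fun x y hxy => by
    have := DFunLike.congr_fun hxy e
    change f x e = f y e at this
    rwa [(he x).1, (he y).1] at this
  have hr : Function.Injective hp.right := fun x y hxy => by
    have := DFunLike.congr_fun hxy e
    change f e x = f e y at this
    rwa [(he x).2, (he y).2] at this
  rcases hnuc with h | h | h
  · have := card_le_of_left_nucleus hA hB E hp.mul_zero (H := leftNucleus f)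
      (X := fun i => hp.left i) (Z := fun i => hp.left i) (fun i x y => (i.2 x y).symm)
      (hl.comp Subtype.val_injective)
    omega
  · have := card_le_of_middle_nucleus hA E (H := middleNucleus f)
      (X := fun i => hp.right i) (Y := fun i => -hp.left i) (fun i x y => by
        change f (f x i) y + f x (-f i y) = 0
        rw [i.2 x y, hp.mul_neg, add_neg_cancel]) (hr.comp Subtype.val_injective)
    omega
  · have := card_le_of_right_nucleus hA hB E hp.zero_mul (H := rightNucleus f)
      (Y := fun i => hp.right i) (Z := fun i => hp.right i) (fun i x y => i.2 x y)
      (hr.comp Subtype.val_injective)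
    omega

variable {B : L × L →+ L × L →+ ZMod p}

theorem false_of_dickson (hA : Admissible p σ α η) (hL : p ^ 2 < Nat.card L) (hB : IsInner B)
    {s t r : RingAut L} {a : L}
    (E : SlotEquiv (triForm (prodTrace p L) (newMul σ (σ ^ 3) α η))
      (triForm B (dicksonMul s t r a))) : False := by
  let φ : L × L × L →+ L := AddMonoidHom.mk'
    (fun q => s (r q.1 + t q.2.2 - q.2.1) + q.2.2 - q.1 - q.2.1) fun x y => by
      simp only [Prod.fst_add, Prod.snd_add, map_add, map_sub]; ring
  have hφ : ∀ q, φ q = s (r q.1 + t q.2.2 - q.2.1) + q.2.2 - q.1 - q.2.1 := fun _ => rfl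
  refine false_of_derivations hA hL hB E (H := φ.ker)
    (X := fun q => diagMul (r q.1.1 + t q.1.2.2 - q.1.2.1) q.1.1)
    (Y := fun q => diagMul q.1.2.1 q.1.2.2)
    (Z := fun q => diagMul (r q.1.1 + t q.1.2.2) (q.1.1 + q.1.2.1)) ?_ ?_ ?_
  · have h1 := card_le_card_ker_mul φ
    rw [Nat.card_prod, Nat.card_prod, ← mul_assoc] at h1
    exact Nat.le_of_mul_le_mul_right h1 Nat.card_pos
  · rintro ⟨⟨b, c, d⟩, hq⟩ x y
    have hq' : φ (b, c, d) = 0 := hq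
    simp only [hφ, map_sub, map_add] at hq'
    simp only [dicksonMul, diagMul_apply, map_mul, map_add, map_sub, Prod.mk_add_mk, Prod.mk.injEq]
    constructor
    · ring
    · linear_combination -s x.1 * y.2 * hq'
  · rintro ⟨⟨b, c, d⟩, hq⟩ ⟨⟨b', c', d'⟩, hq'⟩ h1 h2
    have h3 := (diagMul_injective h1).2
    have h4 := diagMul_injective h2
    simp only at h3 h4
    simp [h3, h4.1, h4.2]

theorem false_of_diag (hA : Admissible p σ α η) (hL : p ^ 2 < Nat.card L) (hB : IsInner B)
    {f : L × L → L × L → L × L}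
    (E : SlotEquiv (triForm (prodTrace p L) (newMul σ (σ ^ 3) α η)) (triForm B f))
    {a c u w : L → L → L}
    (h : ∀ b d x y, diagMul (u b d) (w b d) (f x y) =
      f (diagMul (a b d) b x) y + f x (diagMul (c b d) d y)) : False := by
  refine false_of_derivations hA hL hB E (H := L × L) (by rw [Nat.card_prod])
    (X := fun q => diagMul (a q.1 q.2) q.1) (Y := fun q => diagMul (c q.1 q.2) q.2)
    (Z := fun q => diagMul (u q.1 q.2) (w q.1 q.2)) (fun q => h q.1 q.2) fun q q' h1 h2 => ?_
  exact Prod.ext (diagMul_injective h1).2 (diagMul_injective h2).2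

theorem false_of_knuthI (hA : Admissible p σ α η) (hL : p ^ 2 < Nat.card L) (hB : IsInner B)
    {s : RingAut L} {a b : L}
    (E : SlotEquiv (triForm (prodTrace p L) (newMul σ (σ ^ 3) α η))
      (triForm B (knuthIMul s a b))) : False := by
  refine false_of_diag hA hL hB E (a := fun b d => b + s.symm (s.symm d) - s.symm d)
    (c := fun b d => s b + s.symm d - b) (u := fun b d => s b + s.symm (s.symm d))
    (w := fun b d => s b + s.symm d) fun b d x y => ?_
  simp only [knuthIMul, diagMul_apply, map_mul, map_add, map_sub, RingEquiv.apply_symm_apply,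
    Prod.mk_add_mk, Prod.mk.injEq]
  constructor <;> ring

theorem false_of_knuthII (hA : Admissible p σ α η) (hL : p ^ 2 < Nat.card L) (hB : IsInner B)
    {s : RingAut L} {a b : L}
    (E : SlotEquiv (triForm (prodTrace p L) (newMul σ (σ ^ 3) α η))
      (triForm B (knuthIIMul s a b))) : False := by
  refine false_of_diag hA hL hB E (a := fun b _ => b)
    (c := fun b d => s b + d - b) (u := fun b d => s b + d)
    (w := fun b d => s b + d) fun b d x y => ?_
  simp only [knuthIIMul, diagMul_apply, map_mul, Prod.mk_add_mk, Prod.mk.injEq]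
  constructor <;> ring

theorem false_of_knuthIII (hA : Admissible p σ α η) (hL : p ^ 2 < Nat.card L) (hB : IsInner B)
    {s : RingAut L} {a b : L}
    (E : SlotEquiv (triForm (prodTrace p L) (newMul σ (σ ^ 3) α η))
      (triForm B (knuthIIIMul s a b))) : False := by
  refine false_of_diag hA hL hB E
    (a := fun b d => s.symm b + s.symm (s.symm d) - s.symm d)
    (c := fun _ d => s.symm d) (u := fun b d => s.symm b + s.symm (s.symm d))
    (w := fun b d => b + s.symm d) fun b d x y => ?_
  simp only [knuthIIIMul, diagMul_apply, map_mul, map_add, map_sub, RingEquiv.apply_symm_apply,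
    Prod.mk_add_mk, Prod.mk.injEq]
  constructor <;> ring

theorem false_of_knuthIV (hA : Admissible p σ α η) (hL : p ^ 2 < Nat.card L) (hB : IsInner B)
    {s : RingAut L} {a b : L}
    (E : SlotEquiv (triForm (prodTrace p L) (newMul σ (σ ^ 3) α η))
      (triForm B (knuthIVMul s a b))) : False := by
  refine false_of_diag hA hL hB E (a := fun b _ => s.symm b)
    (c := fun _ d => d) (u := fun b d => s.symm b + d)
    (w := fun b d => b + d) fun b d x y => ?_
  simp only [knuthIVMul, diagMul_apply, map_mul, RingEquiv.apply_symm_apply,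
    Prod.mk_add_mk, Prod.mk.injEq]
  constructor <;> ring

theorem false_of_albert (hA : Admissible p σ α η) (hL : p ^ 2 < Nat.card L)
    {F : Type*} [Field F] [Finite F] (hF : Nat.card L * Nat.card L ≤ Nat.card F)
    {B : F →+ F →+ ZMod p} (hB : IsInner B) {s t : RingAut F} {c : F}
    (E : SlotEquiv (triForm (prodTrace p L) (newMul σ (σ ^ 3) α η))
      (triForm B (albertMul s t c))) : False := by
  let φ : F × F →+ F := AddMonoidHom.mk' (fun q => q.1 + q.2 - s q.1 - t q.2) fun x y => by
      simp only [Prod.fst_add, Prod.snd_add, map_add]; ring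
  have hφ : ∀ q, φ q = q.1 + q.2 - s q.1 - t q.2 := fun _ => rfl
  refine false_of_derivations hA hL hB E (H := φ.ker)
    (X := fun q => AddMonoidHom.mulLeft q.1.1) (Y := fun q => AddMonoidHom.mulLeft q.1.2)
    (Z := fun q => AddMonoidHom.mulLeft (q.1.1 + q.1.2)) ?_ ?_ ?_
  · have h1 := card_le_card_ker_mul φ
    rw [Nat.card_prod] at h1
    exact hF.trans (Nat.le_of_mul_le_mul_right h1 Nat.card_pos)
  · rintro ⟨⟨a, b⟩, hq⟩ x y
    have hq' : φ (a, b) = 0 := hq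
    simp only [hφ] at hq'
    simp only [albertMul, AddMonoidHom.coe_mulLeft, map_mul]
    linear_combination -c * s x * t y * hq'
  · rintro ⟨⟨a, b⟩, hq⟩ ⟨⟨a', b'⟩, hq'⟩ h1 h2
    have h3 := DFunLike.congr_fun h1 1
    have h4 := DFunLike.congr_fun h2 1
    simp only [AddMonoidHom.coe_mulLeft, mul_one] at h3 h4
    simp [h3, h4]

theorem false_of_bierbrauer (hA : Admissible p σ α η) (hB : IsInner B)
    {s : RingAut L} {a b c d h : L}
    (E : SlotEquiv (triForm (prodTrace p L) (newMul σ (σ ^ 3) α η))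
      (triForm B (bierbrauerMul s a b c d h))) : False := by
  obtain ⟨-, ρ, hρ, h1⟩ := torus_weights hA hB E (X := fun e => diagMul e e)
    ⟨fun a b x => by simp [diagMul_apply, add_mul], fun a b x => by simp [diagMul_apply, mul_assoc],
      fun x => by simp [diagMul_apply]⟩ (μ₁ := 1) (ν₁ := s) (μ₂ := 1) (ν₂ := 1) fun e x y => by
      simp only [bierbrauerMul, diagMul_apply, map_mul, RingAut.one_apply, Prod.mk_add_mk,
        Prod.mk.injEq]
      constructor <;> ring
  rw [or_self, mul_one] at h1
  rcases hρ with h2 | h2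
  · exact hA.pow_ne 1 (by norm_num) (by norm_num) (by rw [pow_one, ← h2, h1])
  · exact hA.pow_ne 3 (by norm_num) (by norm_num) (by rw [← h2, h1])

theorem false_of_taniguchi (hA : Admissible p σ α η) (hB : IsInner B)
    {s : RingAut L} {a b h : L}
    (E : SlotEquiv (triForm (prodTrace p L) (newMul σ (σ ^ 3) α η))
      (triForm B (taniguchiMul s a b h))) : False := by
  obtain ⟨⟨ρ, hρ, h1⟩, ρ', hρ', h2⟩ := torus_weights hA hB E (X := fun e => diagMul e (s (s e)))
    ⟨fun a b x => by simp [diagMul_apply, add_mul], fun a b x => by simp [diagMul_apply, mul_assoc],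
      fun x => by simp [diagMul_apply]⟩ (μ₁ := s * s) (ν₁ := s * (s * s)) (μ₂ := 1) (ν₂ := s * s)
      fun e x y => by
      simp only [taniguchiMul, diagMul_apply, map_mul, map_add, map_sub, RingAut.one_apply,
        RingAut.mul_apply, Prod.mk_add_mk, Prod.mk.injEq]
      constructor <;> ring
  have e1 : ∀ {ρ : RingAut L}, (ρ = σ ∨ ρ = σ ^ 3) → ∃ i : ℤ, (i = 1 ∨ i = 3) ∧ ρ = σ ^ i := by
    rintro ρ (rfl | rfl)
    · exact ⟨1, Or.inl rfl, (zpow_one _).symm⟩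
    · exact ⟨3, Or.inr rfl, rfl⟩
  obtain ⟨i, hi, rfl⟩ := e1 hρ
  obtain ⟨j, hj, rfl⟩ := e1 hρ'
  have hs : s = σ ^ i ∨ s = σ ^ (-i) := by
    rcases h1 with h1 | h1
    · exact Or.inl (mul_right_cancel h1)
    · right
      rw [← mul_assoc, eq_comm] at h1
      rw [zpow_neg]
      exact eq_inv_of_mul_eq_one_right (mul_eq_right.1 h1)
  have hss : s * s = σ ^ j ∨ s * s = σ ^ (-j) := by
    rcases h2 with h2 | h2
    · exact Or.inl (by rw [h2, mul_one])
    · right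
      rw [zpow_neg]
      exact eq_inv_of_mul_eq_one_right h2.symm
  have hz := fun {i j} => zpow_inj_of_pow_ne_one hA.pow_ne (i := i) (j := j)
  rcases hs with rfl | rfl <;> rcases hss with h3 | h3 <;> rw [← zpow_add] at h3 <;>
    have h4 := hz h3 (by omega) <;> omega

theorem sq_ne_one_of_card_fixed (hL : p ^ 4 < Nat.card L) {s : RingAut L}
    (hs : Nat.card {x // s x = x} ≤ p ^ 2) : s * s ≠ 1 := by
  intro h
  have h1 := card_eq_card_fixed_pow p s
  have h2 : orderOf s ≤ 2 :=
    Nat.le_of_dvd (by norm_num) (orderOf_dvd_of_pow_eq_one (by rw [pow_two, h]))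
  have hpos : 0 < Nat.card {x // s x = x} :=
    have : Nonempty {x // s x = x} := ⟨⟨0, map_zero s⟩⟩
    Nat.card_pos
  have h3 : Nat.card L ≤ (p ^ 2) ^ 2 := by
    rw [h1]
    exact (Nat.pow_le_pow_right hpos h2).trans (Nat.pow_le_pow_left hs 2)
  rw [← pow_mul] at h3
  exact absurd h3 (not_le.2 hL)

theorem false_of_dempwolff (hA : Admissible p σ α η) (hL : p ^ 4 < Nat.card L) (hB : IsInner B)
    {s t : RingAut L} {a h : L} (ha : s a = a) (hsq : ¬ IsSquare a)
    (hf : IsPresemifield (dempwolffMul s t a h))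
    (E : SlotEquiv (triForm (prodTrace p L) (newMul σ (σ ^ 3) α η))
      (triForm B (dempwolffMul s t a h))) : False := by
  have hcard : Nat.card {x // s x = x} ≤ p ^ 2 := by
    refine card_le_of_right_nucleus hA hB E hf.zero_mul (Y := fun k => diagMul k.1 k.1)
      (Z := fun k => diagMul k.1 k.1) (fun k x y => ?_) fun k k' hk =>
        Subtype.ext (diagMul_injective hk).1
    have hk := k.2
    have hk' : s.symm k.1 = k.1 := by rw [RingEquiv.symm_apply_eq, hk]
    simp only [dempwolffMul, diagMul_apply, map_mul, hk, hk', Prod.mk.injEq]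
    constructor <;> ring
  have hs2 := sq_ne_one_of_card_fixed hL hcard
  have ha' : s.symm a = a := by rw [RingEquiv.symm_apply_eq, ha]
  let N : L × L →+ L × L := AddMonoidHom.mk' (fun y => (y.2, a * y.1)) fun x y => by
    simp [mul_add]
  have hN : ∀ y, N y = (y.2, a * y.1) := fun _ => rfl
  obtain ⟨X, hX⟩ := exists_middle_of_right hA hB E hf.zero_mul hf.neg_mul (Y := N) (Z := N)
    fun x y => by
      simp only [dempwolffMul, hN, map_mul, ha, ha', Prod.mk.injEq]
      constructor <;> ring
  have hX1 : ∀ y, N y = dempwolffMul s t a h (X (1, 0)) y := fun y => by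
    rw [← hX]
    simp [dempwolffMul]
  obtain ⟨z, hz⟩ : ∃ z, s z ≠ s.symm z := by
    by_contra hcon
    push Not at hcon
    refine hs2 (RingEquiv.ext fun x => ?_)
    change s (s x) = x
    rw [hcon x, RingEquiv.apply_symm_apply]
  obtain ⟨w, hw⟩ : ∃ w, s w ≠ w := by
    by_contra hcon
    push Not at hcon
    exact hs2 (RingEquiv.ext fun x => by change s (s x) = x; rw [hcon, hcon])
  set c := X (1, 0)
  have key : ∀ b z, c.2 * (s b - b) * s z = h * t c.2 * (s.symm b - b) * s.symm z := by
    intro b z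
    have h1 := congrArg Prod.fst (hX1 (0, b * z))
    have h2 := congrArg Prod.fst (hX1 (0, z))
    simp only [dempwolffMul, hN, map_mul] at h1 h2
    linear_combination b * h2 - h1
  have hc2 : c.2 = 0 := by
    have k1 := key w 1
    have k2 := key w z
    simp only [map_one, mul_one] at k1
    have k3 : c.2 * (s w - w) * (s z - s.symm z) = 0 := by
      linear_combination k2 - s.symm z * k1
    exact (mul_eq_zero.1 ((mul_eq_zero.1 k3).resolve_right (sub_ne_zero.2 hz))).resolve_right
      (sub_ne_zero.2 hw)
  have h3 := congrArg Prod.snd (hX1 (1, 0))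
  simp only [dempwolffMul, hN, hc2, map_zero, mul_zero, zero_mul, mul_one, add_zero, sub_zero] at h3
  exact hsq (by rw [h3]; exact ⟨0, by simp⟩)

end Families

/-! ## Irreducible semilinear maps -/

section Semilinear

variable {K : Type*} [Field K]

theorem exists_prod_pow_eq (p : ℕ) [Fact p.Prime] [Algebra (ZMod p) K] [Finite K]
    {s : RingAut K} {c : K} (hc : s c = c) : ∃ u, ∏ i ∈ range (orderOf s), (s ^ i) u = c := by
  classical
  let g := ringAutEquivGal p s
  have hg : ∀ x, g x = s x := fun _ => rfl
  have ho : orderOf g = orderOf s := MulEquiv.orderOf_eq (ringAutEquivGal p) s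
  have hpow : ∀ (i : ℕ) x, (g ^ i) x = (s ^ i) x := fun i x => by
    induction i generalizing x with
    | zero => rfl
    | succ i ih => rw [pow_succ, pow_succ, AlgEquiv.mul_apply, RingAut.mul_apply, ih, hg]
  let F := IntermediateField.fixedField (Subgroup.zpowers g)
  have hcF : c ∈ F := by
    rw [IntermediateField.mem_fixedField_iff]
    intro k hk
    have hs : g ∈ MulAction.stabilizer (Gal(K/ZMod p)) c := hc
    exact (Subgroup.zpowers_le.2 hs) hk
  obtain ⟨u, hu⟩ := FiniteField.norm_surjective F K ⟨c, hcF⟩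
  refine ⟨u, ?_⟩
  have h1 := Algebra.norm_eq_prod_automorphisms F u
  rw [hu] at h1
  change c = _ at h1
  rw [h1, ← ho, prod_range]
  have hfo : IsOfFinOrder g := isOfFinOrder_of_finite g
  refine Fintype.prod_equiv ((finEquivZPowers hfo).trans
    (IntermediateField.subgroupEquivAlgEquiv (Subgroup.zpowers g)).toEquiv) _ _ fun i => ?_
  rw [← hpow]
  rfl

variable {V : Type*} [AddCommGroup V] [Module K V]

/-- A bijective additive map that is semilinear and has no proper invariant subspace. -/
structure IrreducibleSemilinear (s : RingAut K) (T : V →+ V) : Prop where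
  map_smul : ∀ (c : K) v, T (c • v) = s c • T v
  injective : Function.Injective T
  eq_bot_or_eq_top : ∀ U : Submodule K V, (∀ v ∈ U, T v ∈ U) → U = ⊥ ∨ U = ⊤

theorem sum_pow_smul_eq_zero [Finite K] {s : RingAut K} {k : ℕ}
    (hk : k ≤ orderOf s) {v : ℕ → V} (h : ∀ c : K, ∑ i ∈ range k, (s ^ i) c • v i = 0) {i : ℕ}
    (hi : i < k) : v i = 0 := by
  by_contra hv
  obtain ⟨φ, hφ⟩ : ∃ φ : Module.Dual K V, φ (v i) ≠ 0 := by
    by_contra hcon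
    push Not at hcon
    exact hv ((Module.forall_dual_apply_eq_zero_iff K _).1 hcon)
  have hli := (linearIndependent_monoidHom K K).comp
    (fun i : Fin k => (((s ^ (i : ℕ) : RingAut K) : K →+* K) : K →* K)) (by
      intro i j hij
      have h1 : s ^ (i : ℕ) = s ^ (j : ℕ) := RingEquiv.ext fun x => DFunLike.congr_fun hij x
      exact Fin.ext (pow_injOn_Iio_orderOf (i.2.trans_le hk) (j.2.trans_le hk) h1))
  rw [Fintype.linearIndependent_iff] at hli
  refine hφ (hli (fun i => φ (v i)) ?_ ⟨i, hi⟩)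
  funext c
  have h2 := congrArg φ (h c)
  rw [map_sum, map_zero, sum_range] at h2
  simp only [map_smul, smul_eq_mul] at h2
  simp only [Finset.sum_apply, Pi.smul_apply, Function.comp_apply, smul_eq_mul, Pi.zero_apply]
  rw [← h2]
  exact sum_congr rfl fun j _ => mul_comm _ _

namespace IrreducibleSemilinear

variable {s : RingAut K} {T : V →+ V}

theorem iterate_smul (hT : IrreducibleSemilinear s T) (i : ℕ) (c : K) (v : V) :
    T^[i] (c • v) = (s ^ i) c • T^[i] v := by
  induction i generalizing c v with
  | zero => rfl
  | succ i ih =>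
    rw [Function.iterate_succ_apply, hT.map_smul, ih, ← RingAut.mul_apply, ← pow_succ]
    rfl

theorem finrank_le_of_mem_span (hT : IrreducibleSemilinear s T) [Nontrivial V] {k : ℕ} {v : V}
    (hv : v ≠ 0) (h : T^[k] v ∈ Submodule.span K (Set.range fun i : Fin k => T^[i] v)) :
    Module.finrank K V ≤ k := by
  set U := Submodule.span K (Set.range fun i : Fin k => T^[i] v) with hU
  have hmem : ∀ i < k, T^[i] v ∈ U := fun i hi => Submodule.subset_span ⟨⟨i, hi⟩, rfl⟩
  have hinv : ∀ u ∈ U, T u ∈ U := by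
    intro u hu
    induction hu using Submodule.span_induction with
    | mem x hx =>
      obtain ⟨i, rfl⟩ := hx
      change T (T^[i] v) ∈ U
      rw [← Function.iterate_succ_apply' T]
      rcases Nat.lt_or_ge (i + 1) k with hi | hi
      · exact hmem _ hi
      · have : (i : ℕ) + 1 = k := by omega
        rwa [Nat.succ_eq_add_one, this]
    | zero => rw [map_zero]; exact U.zero_mem
    | add x y _ _ hx hy => rw [map_add]; exact U.add_mem hx hy
    | smul c x _ hx => rw [hT.map_smul]; exact U.smul_mem _ hx
  rcases hT.eq_bot_or_eq_top U hinv with h1 | h1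
  · rcases Nat.eq_zero_or_pos k with rfl | hk
    · exact absurd (by rw [h1] at h; exact h) hv
    · exact absurd (by have := hmem 0 hk; rw [h1] at this; exact this) hv
  · have h2 := finrank_range_le_card (R := K) fun i : Fin k => T^[i] v
    rw [Set.finrank, ← hU, h1, finrank_top, Fintype.card_fin] at h2
    exact h2

/-- Additive maps commuting with the scalars and with `T`. -/
def commutant (K : Type*) [Field K] {V : Type*} [AddCommGroup V] [Module K V] (T : V →+ V) :
    AddSubgroup (V →+ V) where
  carrier := {e | (∀ v, e (T v) = T (e v)) ∧ ∀ (c : K) v, e (c • v) = c • e v}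
  add_mem' := fun {a b} ha hb => ⟨fun v => by simp [ha.1, hb.1], fun c v => by simp [ha.2, hb.2]⟩
  zero_mem' := ⟨fun v => by simp, fun c v => by simp⟩
  neg_mem' := fun {a} ha => ⟨fun v => by simp [ha.1], fun c v => by simp [ha.2]⟩

theorem iterate_comm {e : V →+ V} (he : e ∈ commutant K T) (i : ℕ) (v : V) :
    e (T^[i] v) = T^[i] (e v) := by
  induction i generalizing v with
  | zero => rfl
  | succ i ih => rw [Function.iterate_succ_apply, ih, he.1, ← Function.iterate_succ_apply]

/-- The power of `T` that is linear. -/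
noncomputable def linPow (s : RingAut K) (T : V →+ V) : V →+ V :=
  AddMonoidHom.mk' (T^[orderOf s]) fun x y => iterate_map_add T _ x y

theorem linPow_mem (hT : IrreducibleSemilinear s T) : linPow s T ∈ commutant K T := by
  refine ⟨fun v => ?_, fun c v => ?_⟩
  · exact (Function.iterate_succ_apply T _ v).symm.trans (Function.iterate_succ_apply' T _ v)
  · change T^[orderOf s] (c • v) = c • T^[orderOf s] v
    rw [hT.iterate_smul, pow_orderOf_eq_one, RingAut.one_apply]

theorem card_fixed_le [Nontrivial V] [Finite V] (hT : IrreducibleSemilinear s T) :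
    Nat.card {x // s x = x} ≤ Nat.card (commutant K T) := by
  have : Finite (V →+ V) := Finite.of_injective _ DFunLike.coe_injective
  obtain ⟨v, hv⟩ := exists_ne (0 : V)
  refine Nat.card_le_card_of_injective (fun k => (⟨DistribSMul.toAddMonoidHom V k.1,
    fun v => ?_, fun c v => ?_⟩ : commutant K T)) fun k k' h => Subtype.ext ?_
  · change k.1 • T v = T (k.1 • v)
    rw [hT.map_smul, k.2]
  · exact smul_comm _ _ _
  · have := DFunLike.congr_fun (congrArg Subtype.val h) v
    exact smul_left_injective K hv this

theorem finrank_le_two_mul [Nontrivial V] [Finite V] {p : ℕ} [Fact p.Prime] [Module (ZMod p) V]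
    [Algebra (ZMod p) K] [IsScalarTower (ZMod p) K V]
    (hT : IrreducibleSemilinear s T) (hp : Nat.card (commutant K T) ≤ p ^ 2) :
    Module.finrank K V ≤ 2 * orderOf s := by
  have : Finite (V →+ V) := Finite.of_injective _ DFunLike.coe_injective
  set n := orderOf s
  obtain ⟨v, hv⟩ := exists_ne (0 : V)
  have hz := hT.linPow_mem
  have hs : ∀ (c : ZMod p) (e : commutant K T), c • e.1 ∈ commutant K T := fun c e =>
    ⟨fun v => by
      rw [AddMonoidHom.smul_apply, AddMonoidHom.smul_apply, e.2.1]
      exact (ZMod.map_smul T c (e.1 v)).symm, fun k v => by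
      rw [AddMonoidHom.smul_apply, AddMonoidHom.smul_apply, e.2.2, smul_comm]⟩
  have hzz : (linPow s T).comp (linPow s T) ∈ commutant K T :=
    ⟨fun v => by simp [hz.1], fun c v => by simp [hz.2]⟩
  have hone : AddMonoidHom.id V ∈ commutant K T := ⟨fun v => rfl, fun c v => rfl⟩
  let F : ZMod p × ZMod p × ZMod p → commutant K T := fun q =>
    ⟨q.1 • AddMonoidHom.id V, hs _ ⟨_, hone⟩⟩ + ⟨q.2.1 • linPow s T, hs _ ⟨_, hz⟩⟩ +
      ⟨q.2.2 • (linPow s T).comp (linPow s T), hs _ ⟨_, hzz⟩⟩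
  have hF : ¬ Function.Injective F := fun h => by
    have h1 := (Nat.card_le_card_of_injective F h).trans hp
    simp only [Nat.card_prod, Nat.card_zmod] at h1
    have h2 : p ^ 2 < p ^ 3 := Nat.pow_lt_pow_right (Fact.out : p.Prime).one_lt (by norm_num)
    have h3 : p ^ 3 = p * (p * p) := by ring
    omega
  obtain ⟨a, b, c, hne, h⟩ : ∃ a b c : ZMod p, (a, b, c) ≠ 0 ∧
      a • v + b • T^[n] v + c • T^[n] (T^[n] v) = 0 := by
    rw [Function.Injective] at hF
    push Not at hF
    obtain ⟨q, q', h1, h2⟩ := hF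
    refine ⟨q.1 - q'.1, q.2.1 - q'.2.1, q.2.2 - q'.2.2, sub_ne_zero.2 h2, ?_⟩
    have h3 : q.1 • v + q.2.1 • T^[n] v + q.2.2 • T^[n] (T^[n] v) =
      q'.1 • v + q'.2.1 • T^[n] v + q'.2.2 • T^[n] (T^[n] v) :=
      DFunLike.congr_fun (congrArg Subtype.val h1) v
    rw [sub_smul, sub_smul, sub_smul]
    rw [← sub_eq_zero] at h3
    rw [← h3]
    abel
  have hsp : ∀ k : ℕ, ∀ c : ZMod p, c ≠ 0 → ∀ u ∈ Submodule.span K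
      (Set.range fun i : Fin k => T^[i] v), u + c • T^[k] v = 0 → Module.finrank K V ≤ k := by
    intro k c hc u hu h
    refine hT.finrank_le_of_mem_span hv ?_
    have h1 : T^[k] v = c⁻¹ • -u := by
      rw [eq_inv_smul_iff₀ hc]
      exact eq_neg_of_add_eq_zero_right h
    rw [h1, ← algebraMap_smul K]
    exact Submodule.smul_mem _ _ (Submodule.neg_mem _ hu)
  have hmem : ∀ (c : ZMod p) (i k : ℕ), i < k → c • T^[i] v ∈ Submodule.span K
      (Set.range fun i : Fin k => T^[i] v) := fun c i k hik => by
    rw [← algebraMap_smul K]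
    exact Submodule.smul_mem _ _ (Submodule.subset_span ⟨⟨i, hik⟩, rfl⟩)
  have : Finite K := Finite.of_injective (fun c : K => c • v) (smul_left_injective K hv)
  have hn : 0 < n := by
    have := finite_ringAut (L := K) p
    exact orderOf_pos s
  by_cases hc : c = 0
  · subst hc
    rw [zero_smul, add_zero] at h
    by_cases hb : b = 0
    · subst hb
      rw [zero_smul, add_zero] at h
      have ha : a ≠ 0 := fun ha => hne (by rw [ha]; rfl)
      exact absurd ((smul_eq_zero_iff_right ha).1 h) hv
    · have := hsp n b hb (a • v) (hmem a 0 n hn) h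
      omega
  · refine hsp _ c hc _ (Submodule.add_mem _ (hmem a 0 _ (by omega)) (hmem b n _ (by omega))) ?_
    rw [two_mul, Function.iterate_add_apply]
    exact h

/-- A semilinear map whose linear power is a scalar has an invariant line. -/
theorem finrank_le_one [Nontrivial V] [Finite K] {p : ℕ} [Fact p.Prime] [Algebra (ZMod p) K]
    (hT : IrreducibleSemilinear s T) {c : K} (hc : ∀ v, T^[orderOf s] v = c • v) :
    Module.finrank K V ≤ 1 := by
  have := finite_ringAut (L := K) p
  set n := orderOf s with hn
  have hn0 : 0 < n := orderOf_pos s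
  obtain ⟨v, hv⟩ := exists_ne (0 : V)
  have hinj : ∀ i, Function.Injective T^[i] := fun i => hT.injective.iterate i
  have h0 : ∀ i u, u ≠ 0 → T^[i] u ≠ 0 := fun i u hu h =>
    hu (hinj i (h.trans (iterate_map_zero T i).symm))
  have hsc : s c = c := by
    have h1 : T (T^[n] v) = T^[n] (T v) := by
      rw [← Function.iterate_succ_apply' T, Function.iterate_succ_apply]
    rw [hc, hc, hT.map_smul] at h1
    exact smul_left_injective K (h0 1 v hv) h1
  have hc0 : c ≠ 0 := by
    rintro rfl
    exact h0 n v hv (by rw [hc, zero_smul])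
  obtain ⟨u, hu⟩ := exists_prod_pow_eq p hsc
  rw [← hn] at hu
  have hu0 : ∀ i, (s ^ i) u ≠ 0 := fun i h => by
    have : u = 0 := (map_eq_zero_iff _ (s ^ i).injective).1 h
    subst this
    refine hc0 (hu.symm.trans (prod_eq_zero (mem_range.2 hn0) (map_zero _)))
  let q : ℕ → K := fun i => ∏ j ∈ range i, (s ^ j) u
  have hq0 : ∀ i, q i ≠ 0 := fun i => prod_ne_zero_iff.2 fun j _ => hu0 j
  have hqs : ∀ i, u * s (q i) = q (i + 1) := fun i => by
    simp only [q]
    rw [prod_range_succ', map_prod, pow_zero, RingAut.one_apply, mul_comm]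
    congr 1
    exact prod_congr rfl fun j _ => by rw [pow_succ', RingAut.mul_apply]
  let w : K → V := fun a => ∑ i ∈ range n, (q i)⁻¹ • T^[i] (a • v)
  have hw : ∀ a, T (w a) = u • w a := by
    intro a
    have h1 : ∀ i, T ((q i)⁻¹ • T^[i] (a • v)) = u • ((q (i + 1))⁻¹ • T^[i + 1] (a • v)) := by
      intro i
      rw [hT.map_smul, map_inv₀, ← hqs, smul_smul, Function.iterate_succ_apply' T, mul_inv,
        ← mul_assoc, show u * u⁻¹ = 1 from mul_inv_cancel₀ (hu0 0), one_mul]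
    simp only [w, map_sum, h1, ← smul_sum]
    congr 1
    have h2 := sum_range_succ (fun i => (q i)⁻¹ • T^[i] (a • v)) n
    rw [sum_range_succ'] at h2
    have h3 : (q n)⁻¹ • T^[n] (a • v) = (q 0)⁻¹ • T^[0] (a • v) := by
      rw [hc, show q n = c from hu, inv_smul_smul₀ hc0]
      simp [q]
    rw [h3] at h2
    exact add_right_cancel h2
  obtain ⟨a, ha⟩ : ∃ a, w a ≠ 0 := by
    by_contra hcon
    push Not at hcon
    have h1 := sum_pow_smul_eq_zero (K := K) (s := s) (v := fun i => (q i)⁻¹ • T^[i] v)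
      hn.ge (fun a => by
        rw [← hcon a]
        refine sum_congr rfl fun i _ => ?_
        rw [hT.iterate_smul, smul_comm]) hn0
    simp only [q, range_zero, prod_empty, inv_one, one_smul] at h1
    exact hv h1
  refine hT.finrank_le_of_mem_span (k := 1) ha ?_
  change T (w a) ∈ _
  rw [hw]
  exact Submodule.smul_mem _ _ (Submodule.subset_span ⟨0, rfl⟩)

theorem finrank_le_one_of_expansion [Nontrivial V] [Finite K] {p : ℕ} [Fact p.Prime]
    [Algebra (ZMod p) K] (hT : IrreducibleSemilinear s T) {k : ℕ} (hk : 0 < k)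
    (hks : k < orderOf s) (hsurj : Function.Surjective T) {a : ℕ → K}
    (h : ∀ v, linPow s T (T v) = ∑ i ∈ range (k + 1), a i • T^[i] v) :
    Module.finrank K V ≤ 1 := by
  have hz := hT.linPow_mem
  have hone : ∀ v, linPow s T (T v) = a 1 • T v := by
    intro v
    let r : ℕ → V := fun i => if i = 1 then a 1 • T v - linPow s T (T v) else a i • T^[i] v
    have h1 : ∀ c : K, ∑ i ∈ range (k + 1), (s ^ i) c • r i = 0 := by
      intro c
      have h2 := h (c • v)
      have h3 : ∀ i, (s ^ i) c • r i = (a i • T^[i] (c • v)) -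
          if i = 1 then linPow s T (T (c • v)) else 0 := by
        intro i
        rw [hT.iterate_smul]
        by_cases hi : i = 1
        · subst hi
          simp only [r, if_true, hT.map_smul, hz.2, smul_sub, pow_one, Function.iterate_one]
          rw [smul_comm]
        · simp only [r, if_neg hi, sub_zero]
          rw [smul_comm]
      simp only [h3, sum_sub_distrib]
      rw [← h2, sum_ite_eq', if_pos (mem_range.2 (by omega)), sub_self]
    have h4 := sum_pow_smul_eq_zero hks h1 (i := 1) (by omega)
    simp only [r, if_true] at h4
    exact (sub_eq_zero.1 h4).symm
  refine hT.finrank_le_one (p := p) (c := a 1) fun v => ?_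
  obtain ⟨u, rfl⟩ := hsurj v
  exact hone u

end IrreducibleSemilinear

/-- `semilin` as an additive map. -/
def semilinHom {d : ℕ} (s : RingAut K) (M : Matrix (Fin d) (Fin d) K) :
    (Fin d → K) →+ (Fin d → K) :=
  AddMonoidHom.mk' (semilin s M) fun x y => by
    simp only [semilin, Pi.add_apply, map_add]
    exact Matrix.mulVec_add M _ _

theorem semilinInv_semilin {d : ℕ} {s : RingAut K} {M : Matrix (Fin d) (Fin d) K}
    (hM : IsUnit M.det) (v : Fin d → K) : semilinInv s M (semilin s M v) = v := by
  funext i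
  simp only [semilinInv, semilin, Matrix.mulVec_mulVec, Matrix.nonsing_inv_mul M hM,
    Matrix.one_mulVec, RingEquiv.symm_apply_apply]

theorem irreducibleSemilinear_semilinHom {d : ℕ} {s : RingAut K} {M : Matrix (Fin d) (Fin d) K}
    (hM : IsIrreducibleSemilin s M) : IrreducibleSemilinear s (semilinHom s M) where
  map_smul c v := by
    change semilin s M (c • v) = s c • semilin s M v
    simp only [semilin, Pi.smul_apply, smul_eq_mul, map_mul]
    exact Matrix.mulVec_smul M (s c) fun i => s (v i)
  injective := Function.LeftInverse.injective (semilinInv_semilin hM.1)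
  eq_bot_or_eq_top := hM.2

section Families

variable {p : ℕ} [Fact p.Prime] {L : Type*} [Field L] [Algebra (ZMod p) L] [Finite L]
  {σ : RingAut L} {α η : L}

open IrreducibleSemilinear

/-- Degree bounds for a semilinear map whose commutant is contained in a nucleus. -/
theorem IrreducibleSemilinear.degree_bounds [Finite K] [Algebra (ZMod p) K] {d n : ℕ}
    (hd : 0 < d) (hn : 0 < n) (hK : Nat.card K = p ^ n) {s : RingAut K}
    {T : (Fin d → K) →+ (Fin d → K)} (hT : IrreducibleSemilinear s T)
    (hp : Nat.card (commutant K T) ≤ p ^ 2) :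
    n ≤ 2 * orderOf s ∧ d ≤ 2 * orderOf s ∧ orderOf s ≤ n := by
  have hpp : p.Prime := Fact.out
  have : Nonempty (Fin d) := ⟨⟨0, hd⟩⟩
  have h1 := card_eq_card_fixed_pow p s
  rw [hK] at h1
  have h2 := hT.card_fixed_le.trans hp
  have h3 := hT.finrank_le_two_mul hp
  rw [Module.finrank_fin_fun] at h3
  have := finite_ringAut (L := K) p
  obtain ⟨j, -, hj⟩ := (Nat.dvd_prime_pow hpp).1
    ((dvd_pow_self _ (orderOf_pos s).ne').trans (dvd_of_eq h1.symm))
  rw [hj, ← pow_mul] at h1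
  rw [hj] at h2
  have h4 := Nat.pow_right_injective hpp.two_le h1
  have h5 := (Nat.pow_le_pow_iff_right hpp.one_lt).1 h2
  refine ⟨h4.trans_le (Nat.mul_le_mul_right _ h5), h3, ?_⟩
  rw [h4]
  refine Nat.le_mul_of_pos_left _ (Nat.pos_of_ne_zero ?_)
  rintro rfl
  omega

theorem false_of_dempwolffForm (hA : Admissible p σ α η) {n : ℕ} (hn : 6 ≤ n)
    (hL : Nat.card L = p ^ n) {s t : RingAut L} {M : Matrix (Fin 2) (Fin 2) L} {h : L}
    {B : (Fin 2 → L) →+ (Fin 2 → L) →+ ZMod p} (hB : IsInner B)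
    (hM : IsIrreducibleSemilin s M) (hf : IsPresemifield (dempwolffFormMul s t M h))
    (E : SlotEquiv (triForm (prodTrace p L) (newMul σ (σ ^ 3) α η))
      (triForm B (dempwolffFormMul s t M h))) : False := by
  have hT := irreducibleSemilinear_semilinHom hM
  set T := semilinHom s M with hTdef
  have hTv : ∀ v, semilin s M v = T v := fun _ => rfl
  have hsurj : Function.Surjective T := Finite.surjective_of_injective hT.injective
  have hinv : ∀ v, semilinInv s M (T v) = v := semilinInv_semilin hM.1
  have hcomm : ∀ e ∈ commutant L T, ∀ x y,
      e (dempwolffFormMul s t M h x y) = dempwolffFormMul s t M h x (e y) := by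
    intro e he x y
    obtain ⟨u, rfl⟩ := hsurj y
    simp only [dempwolffFormMul, map_add, he.2, hTv, hinv, he.1]
  have hcard : Nat.card (commutant L T) ≤ p ^ 2 :=
    card_le_of_right_nucleus hA hB E hf.zero_mul (H := commutant L T) (Y := fun e => e.1)
      (Z := fun e => e.1) (fun e => hcomm e.1 e.2) Subtype.val_injective
  obtain ⟨h1, -, -⟩ := hT.degree_bounds (by norm_num) (by omega) hL hcard
  obtain ⟨X, hX⟩ := exists_middle_of_right hA hB E hf.zero_mul hf.neg_mul
    (hcomm _ hT.linPow_mem)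
  set x := X ![1, 0]
  have h2 := hT.finrank_le_one_of_expansion (p := p) (k := 2) (by norm_num) (by omega) hsurj
    (a := fun i => if i = 0 then h * t (x 1) else if i = 1 then x 0 else x 1) fun v => by
      have h3 := hX ![1, 0] (T v)
      simp only [dempwolffFormMul, hTv, hinv] at h3
      simp only [sum_range_succ, sum_range_zero]
      simp only [Matrix.cons_val_zero, Matrix.cons_val_one, one_smul, zero_smul, map_zero,
        mul_zero, add_zero] at h3
      rw [h3]
      simp [x]
      abel
  rw [Module.finrank_fin_fun] at h2
  omega

theorem false_of_twistedCyclic_one (hA : Admissible p σ α η) (hL : p ^ 2 < Nat.card L)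
    [Finite K] (hK : Nat.card L * Nat.card L ≤ Nat.card K)
    {s r : RingAut K} {M : Matrix (Fin 1) (Fin 1) K} {h : K}
    {B : (Fin 1 → K) →+ (Fin 1 → K) →+ ZMod p} (hB : IsInner B)
    (E : SlotEquiv (triForm (prodTrace p L) (newMul σ (σ ^ 3) α η))
      (triForm B (twistedCyclicMul one_pos s r M h))) : False := by
  let φ : K × K →+ K := AddMonoidHom.mk' (fun q => q.1 + q.2 - s q.1 - r q.2) fun x y => by
      simp only [Prod.fst_add, Prod.snd_add, map_add]; ring
  have hφ : ∀ q, φ q = q.1 + q.2 - s q.1 - r q.2 := fun _ => rfl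
  refine false_of_derivations hA hL hB E (H := φ.ker)
    (X := fun q => DistribSMul.toAddMonoidHom _ q.1.1)
    (Y := fun q => DistribSMul.toAddMonoidHom _ q.1.2)
    (Z := fun q => DistribSMul.toAddMonoidHom _ (q.1.1 + q.1.2)) ?_ ?_ ?_
  · have h1 := card_le_card_ker_mul φ
    rw [Nat.card_prod] at h1
    exact hK.trans (Nat.le_of_mul_le_mul_right h1 Nat.card_pos)
  · rintro ⟨⟨a, b⟩, hq⟩ x y
    have hq' : φ (a, b) = 0 := hq
    simp only [hφ] at hq'
    funext i
    fin_cases i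
    simp only [twistedCyclicMul, DistribSMul.toAddMonoidHom_apply, Fin.sum_univ_one, semilin,
      Matrix.mulVec, dotProduct, Pi.add_apply, Pi.smul_apply, smul_eq_mul, map_mul,
      Function.iterate_one, Fin.val_zero, Function.iterate_zero, id, Fin.zero_eta]
    linear_combination h * r (y 0) * M 0 0 * s (x 0) * hq'
  · rintro ⟨⟨a, b⟩, hq⟩ ⟨⟨a', b'⟩, hq'⟩ h1 h2
    have h3 := congrFun (DFunLike.congr_fun h1 fun _ => 1) 0
    have h4 := congrFun (DFunLike.congr_fun h2 fun _ => 1) 0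
    simp only [DistribSMul.toAddMonoidHom_apply, Pi.smul_apply, smul_eq_mul, mul_one] at h3 h4
    simp [h3, h4]

theorem false_of_twistedCyclic (hA : Admissible p σ α η) [Finite K] [Algebra (ZMod p) K]
    {d n l : ℕ} (hd : 1 < d) (hn : 0 < n) (hK : Nat.card K = p ^ n) (hl : l.Prime)
    (hl11 : 11 ≤ l) (hdn : d * n = 2 * (2 * l)) (hd0 : 0 < d)
    {s r : RingAut K} {M : Matrix (Fin d) (Fin d) K} {h : K}
    {B : (Fin d → K) →+ (Fin d → K) →+ ZMod p} (hB : IsInner B)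
    (hM : IsIrreducibleSemilin s M) (hf : IsPresemifield (twistedCyclicMul hd0 s r M h))
    (E : SlotEquiv (triForm (prodTrace p L) (newMul σ (σ ^ 3) α η))
      (triForm B (twistedCyclicMul hd0 s r M h))) : False := by
  have hT := irreducibleSemilinear_semilinHom hM
  set T := semilinHom s M with hTdef
  have hTv : semilin s M = T := rfl
  have : Nonempty (Fin d) := ⟨⟨0, hd0⟩⟩
  have hsurj : Function.Surjective T := Finite.surjective_of_injective hT.injective
  have hcomm : ∀ e ∈ commutant K T, ∀ x y,
      e (twistedCyclicMul hd0 s r M h x y) = twistedCyclicMul hd0 s r M h (e x) y := by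
    intro e he x y
    simp only [twistedCyclicMul, map_add, map_sum, he.2, hTv, iterate_comm he]
  have hcard : Nat.card (commutant K T) ≤ p ^ 2 :=
    card_le_of_left_nucleus hA hB E hf.mul_zero (H := commutant K T) (X := fun e => e.1)
      (Z := fun e => e.1) (fun e => hcomm e.1 e.2) Subtype.val_injective
  obtain ⟨h1, h2, h3⟩ := hT.degree_bounds hd0 hn hK hcard
  rcases Nat.lt_or_ge d (orderOf s) with hds | hds
  · obtain ⟨Y, hY⟩ := exists_middle_of_left hA hB E hf.mul_zero hf.mul_neg
      (hcomm _ hT.linPow_mem)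
    let e : Fin d → K := Pi.single ⟨1, hd⟩ 1
    have he0 : e ⟨0, hd0⟩ = 0 := Pi.single_eq_of_ne (by simp) _
    set y := Y e
    have h4 := hT.finrank_le_one_of_expansion (p := p) (k := d) hd0 hds hsurj
      (a := fun i => if hi : i < d then y ⟨i, hi⟩ else h * r (y ⟨0, hd0⟩)) fun v => by
        have h5 := hY v e
        simp only [twistedCyclicMul, hTv, he0, map_zero, mul_zero, zero_smul, add_zero] at h5
        rw [Finset.sum_eq_single (⟨1, hd⟩ : Fin d) (fun i _ hi => by
          rw [show e i = 0 from Pi.single_eq_of_ne hi _, zero_smul]) (by simp)] at h5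
        rw [show e ⟨1, hd⟩ = 1 from Pi.single_eq_same _ _, one_smul] at h5
        rw [hT.linPow_mem.1]
        refine h5.trans ?_
        rw [sum_range_succ, dif_neg (lt_irrefl d), sum_range]
        congr 1
        exact sum_congr rfl fun i _ => by rw [dif_pos i.2]
    rw [Module.finrank_fin_fun] at h4
    omega
  · have hdvd : l ∣ d * n := ⟨4, by rw [hdn]; ring⟩
    rcases (Nat.Prime.dvd_mul hl).1 hdvd with ⟨k, rfl⟩ | ⟨k, rfl⟩
    · have h5 : k * n = 4 := Nat.eq_of_mul_eq_mul_left hl.pos (by rw [← mul_assoc, hdn]; ring)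
      have h6 : n ≤ 4 := Nat.le_of_dvd (by norm_num) ⟨k, by rw [← h5, mul_comm]⟩
      have hk : 0 < k := Nat.pos_of_mul_pos_left hd0
      nlinarith
    · have h5 : d * k = 4 := Nat.eq_of_mul_eq_mul_left hl.pos (by
        rw [mul_left_comm, hdn]; ring)
      have h6 : d ≤ 4 := Nat.le_of_dvd (by norm_num) ⟨k, h5.symm⟩
      have hk : 0 < k := Nat.pos_of_mul_pos_left hn
      nlinarith

end Families

end Semilinear

/-! ## The parameters -/

theorem newMul_isPresemifield {L : Type*} [Field L] {σ τ : RingAut L} {α η : L}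
    (hστ : ∀ x, σ (τ x) = τ (σ x)) (hη : τ η = η)
    (hmem : ∀ a b : L, b ≠ 0 → α ≠ (σ a * a) * (τ b / b)) (hne : ∀ d, d ≠ 0 → σ d ≠ η * d) :
    IsPresemifield (newMul σ τ α η) where
  mul_add x y z := by
    simp only [newMul, Prod.fst_add, Prod.snd_add, map_add, Prod.mk_add_mk, Prod.mk.injEq]
    constructor <;> ring
  add_mul x y z := by
    simp only [newMul, Prod.fst_add, Prod.snd_add, map_add, Prod.mk_add_mk, Prod.mk.injEq]
    constructor <;> ring
  eq_zero_or_eq_zero := by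
    rintro ⟨x₀, x₁⟩ ⟨y₀, y₁⟩ h
    have hη' : τ.symm η = η := by rw [RingEquiv.symm_apply_eq, hη]
    simp only [newMul, hη', Prod.mk_eq_zero] at h ⊢
    obtain ⟨h1, h2⟩ := h
    by_cases hx₀ : x₀ = 0
    · subst hx₀
      simp only [map_zero, zero_mul, zero_add, mul_zero, sub_self, add_zero, mul_eq_zero] at h1 h2
      by_cases hx₁ : x₁ = 0
      · exact Or.inl ⟨rfl, hx₁⟩
      · have hy₀ : y₀ = 0 := (map_eq_zero_iff _ τ.injective).1 (h2.resolve_left hx₁)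
        refine Or.inr ⟨hy₀, by_contra fun hy₁ => hne (y₁ / x₁) (div_ne_zero hy₁ hx₁) ?_⟩
        have hσ : σ x₁ ≠ 0 := (map_ne_zero_iff _ σ.injective).2 hx₁
        rw [map_div₀]
        field_simp
        linear_combination h1
    · right
      have hτ : τ x₀ ≠ 0 := (map_ne_zero_iff _ τ.injective).2 hx₀
      have hσ : σ x₀ ≠ 0 := (map_ne_zero_iff _ σ.injective).2 hx₀
      by_cases hy₀ : y₀ = 0
      · subst hy₀
        simp only [map_zero, mul_zero, add_zero, mul_eq_zero] at h2
        exact ⟨rfl, h2.resolve_left hτ⟩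
      · exfalso
        obtain ⟨t, ht⟩ : ∃ t, y₀ = t * x₀ := ⟨y₀ / x₀, by field_simp⟩
        have ht0 : t ≠ 0 := by
          rintro rfl
          exact hy₀ (by rw [ht, zero_mul])
        have hy₁ : y₁ = -x₁ * τ t := by
          rw [ht, map_mul] at h2
          exact mul_left_cancel₀ hτ (by linear_combination h2)
        have hw : σ t - η * t ≠ 0 := sub_ne_zero.2 (hne t ht0)
        refine hmem (x₁ / x₀) (σ t - η * t) hw ?_
        subst ht hy₁
        simp only [map_mul, map_neg, hστ] at h1
        rw [map_div₀, map_sub, map_mul, hη]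
        field_simp
        linear_combination h1

section Parameters

variable {L : Type*} [Field L]

theorem pow_apply_of_apply_eq {g : RingAut L} {u c : L} (hc : g c = c) (h : g u = c * u) (k : ℕ) :
    (g ^ k) u = c ^ k * u := by
  induction k with
  | zero => simp
  | succ k ih => rw [pow_succ', RingAut.mul_apply, ih, map_mul, map_pow, hc, h]; ring

variable {p : ℕ} [Fact p.Prime] [Algebra (ZMod p) L] [Finite L] {l : ℕ}

theorem exists_frobenius : ∃ g : RingAut L, (∀ x, g x = x ^ p) ∧
    orderOf g = Module.finrank (ZMod p) L := by
  let g := FiniteField.frobeniusAlgEquivOfAlgebraic (ZMod p) L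
  refine ⟨(ringAutEquivGal p).symm g, fun x => ?_, ?_⟩
  · change x ^ Fintype.card (ZMod p) = _
    rw [ZMod.card]
  · rw [MulEquiv.orderOf_eq, FiniteField.orderOf_frobeniusAlgEquivOfAlgebraic]

/-- Parameters of the new family with a small derivation algebra. -/
theorem exists_parameters (hp : p ≠ 2) (hl : l.Prime) (hl11 : 11 ≤ l)
    (hL : Nat.card L = p ^ (2 * l)) : ∃ (σ : RingAut L) (α η : L), Admissible p σ α η ∧
      IsNewParameter σ (σ ^ 3) α η ∧ (σ ^ 3) η = η ∧ IsPresemifield (newMul σ (σ ^ 3) α η) := by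
  classical
  have hpp : p.Prime := Fact.out
  have : Fintype L := Fintype.ofFinite L
  have : CharP L p := charP_of_injective_algebraMap (algebraMap (ZMod p) L).injective p
  have h2 : (2 : L) ≠ 0 := by
    have := (CharP.cast_eq_zero_iff L p 2).not.2 fun h =>
      hp ((Nat.prime_dvd_prime_iff_eq hpp Nat.prime_two).1 h)
    exact_mod_cast this
  have hne1 : (-1 : L) ≠ 1 := fun h => h2 (by linear_combination -h)
  have hodd : Odd p := hpp.odd_of_ne_two hp
  have hlodd : Odd l := hl.odd_of_ne_two (by omega)
  obtain ⟨φ, hφ, hord⟩ := exists_frobenius (p := p) (L := L)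
  have hfin : Module.finrank (ZMod p) L = 2 * l := by
    have h1 := Module.natCard_eq_pow_finrank (K := ZMod p) (V := L)
    rw [hL, Nat.card_zmod] at h1
    exact (Nat.pow_right_injective hpp.two_le h1).symm
  rw [hfin] at hord
  set σ := φ ^ 2 with hσ
  have hσord : orderOf σ = l := by
    rw [hσ, orderOf_pow_of_dvd two_ne_zero (by rw [hord]; exact dvd_mul_right 2 l), hord]
    omega
  have hσl : σ ^ l = 1 := by rw [← hσord, pow_orderOf_eq_one]
  have hτl : (σ ^ 3) ^ l = 1 := by rw [← pow_mul, mul_comm, pow_mul, hσl, one_pow]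
  have hσp : ∀ x, σ x = x ^ (p ^ 2) := fun x => by
    rw [hσ, pow_two, RingAut.mul_apply, hφ, hφ, ← pow_mul, pow_two]
  have hodd' : ∀ k : ℕ, 0 < k → ∃ e, Odd e ∧ ∀ x, (σ ^ k) x = x ^ e := by
    intro k hk
    induction k, hk using Nat.le_induction with
    | base => exact ⟨p ^ 2, hodd.pow, fun x => by
      change (σ ^ 1) x = _
      rw [pow_one, hσp]⟩
    | succ k _ ih =>
      obtain ⟨e, he, h⟩ := ih
      refine ⟨p ^ 2 * e, hodd.pow.mul he, fun x => ?_⟩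
      rw [pow_succ, RingAut.mul_apply, h, hσp, pow_mul]
  have hpow : ∀ j : ℕ, 0 < j → j < 10 → σ ^ j ≠ 1 := fun j h0 hj h => by
    have := Nat.le_of_dvd h0 (orderOf_dvd_of_pow_eq_one h)
    omega
  have hneg : ∀ g : RingAut L, g ^ l = 1 → ∀ u, g u = -u → u = 0 := by
    intro g hg u hu
    have h1 := pow_apply_of_apply_eq (g := g) (u := u) (c := -1) (by simp) (by rw [hu]; ring) l
    rw [hg, RingAut.one_apply, hlodd.neg_one_pow] at h1
    exact (mul_eq_zero.1 (show (2 : L) * u = 0 by linear_combination h1)).resolve_left h2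
  obtain ⟨η, hη⟩ : IsSquare (-1 : L) := by
    rw [FiniteField.isSquare_neg_one_iff, ← Nat.card_eq_fintype_card, hL, pow_mul]
    obtain ⟨k, hk⟩ : Odd (p ^ 2) := hodd.pow
    have h1 : p ^ 2 % 4 = 1 := by
      obtain ⟨j, rfl⟩ := hodd
      ring_nf
      omega
    rw [Nat.pow_mod, h1, one_pow]
    norm_num
  have hη0 : η ≠ 0 := by
    rintro rfl
    simp at hη
  have hση : σ η = η := by
    obtain ⟨j, hj⟩ := hodd
    have h1 : η ^ 4 = 1 := by linear_combination -(η ^ 2 - 1) * hη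
    rw [hσp, hj, show (2 * j + 1) ^ 2 = 4 * (j ^ 2 + j) + 1 by ring, pow_succ, pow_mul, h1,
      one_pow, one_mul]
  have hnorm : ∀ c : L, c * c = -1 → c ^ l ≠ 1 := fun c hc h => by
    apply hne1
    rw [← hlodd.neg_one_pow, ← hc, mul_pow, h, one_mul]
  have htwist : ∀ c : L, σ c = c → c * c = -1 → ∀ d, d ≠ 0 → σ d ≠ c * d := by
    intro c hc hcc d hd h
    have h1 := pow_apply_of_apply_eq hc h l
    rw [hσl, RingAut.one_apply] at h1
    exact hnorm c hcc (mul_right_cancel₀ hd (h1.symm.trans (one_mul d).symm))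
  have hchar : ringChar L ≠ 2 := by
    rw [ringChar.eq L p]
    exact hp
  obtain ⟨α, hα⟩ := FiniteField.exists_nonsquare hchar
  have hα0 : α ≠ 0 := by
    rintro rfl
    exact hα ⟨0, by simp⟩
  have hmem : ∀ a b : L, b ≠ 0 → α ≠ (σ a * a) * ((σ ^ 3) b / b) := by
    rintro a b hb rfl
    refine hα (IsSquare.mul ?_ ?_)
    · obtain ⟨e, ⟨k, rfl⟩, he⟩ := hodd' 1 one_pos
      rw [pow_one] at he
      exact ⟨a ^ (k + 1), by rw [he]; ring⟩
    · obtain ⟨e, ⟨k, rfl⟩, he⟩ := hodd' 3 (by norm_num)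
      refine ⟨b ^ k, ?_⟩
      rw [he, div_eq_iff hb]
      ring
  have hτη : (σ ^ 3) η = η := by
    have := pow_apply_of_apply_eq (g := σ) (u := η) (c := 1) (map_one σ) (by rw [hση, one_mul]) 3
    rwa [one_pow, one_mul] at this
  refine ⟨σ, α, η, ⟨h2, hα0, hη0, hση, hpow, hneg σ hσl, hneg _ hτl, ?_, ?_⟩,
    ⟨hpow 3 (by norm_num) (by norm_num), hpow 2 (by norm_num) (by norm_num), hmem, ?_⟩, hτη,
    newMul_isPresemifield (fun x => ?_) hτη hmem (htwist η hση hη.symm)⟩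
  · have h1 := card_eq_card_fixed_pow p σ
    rw [hL, hσord, pow_mul] at h1
    exact (Nat.pow_left_injective hl.ne_zero h1).ge
  · exact htwist (-η) (by rw [map_neg, hση]) (by rw [neg_mul_neg, hη])
  · have h1 : ∀ i : ℕ, (σ ^ i) η = η := fun i => by
      have := pow_apply_of_apply_eq (g := σ) (u := η) (c := 1) (map_one σ)
        (by rw [hση, one_mul]) i
      rwa [one_pow, one_mul] at this
    rw [fixedNorm, hσord]
    simp only [h1, prod_const, card_range]
    exact hnorm η hη.symm
  · rw [← RingAut.mul_apply, ← RingAut.mul_apply, ← pow_succ, ← pow_succ']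

end Parameters

/-- None of the known semifields is equivalent to a member of the new family with a small
derivation algebra. -/
theorem not_equivalent_of_isKnown {p : ℕ} [Fact p.Prime] {l : ℕ} (hl : l.Prime) (hl11 : 11 ≤ l)
    {σ : RingAut (GaloisField p (2 * l))} {α η : GaloisField p (2 * l)}
    (hA : Admissible p σ α η) {W : Type} [AddCommGroup W] {f : W → W → W}
    (hf : IsKnown p (2 * l) f) : ¬ Equivalent p (newMul σ (σ ^ 3) α η) f := by
  intro h
  obtain ⟨B, hB, hW, ⟨E⟩⟩ := h.exists_slotEquiv (isInner_prodTrace (p := p))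
  have hp1 : 1 < p := (Fact.out : p.Prime).one_lt
  have hL : Nat.card (GaloisField p (2 * l)) = p ^ (2 * l) := GaloisField.card p _ (by omega)
  have hL4 : p ^ 4 < Nat.card (GaloisField p (2 * l)) := by
    rw [hL]
    exact Nat.pow_lt_pow_right hp1 (by omega)
  have hL2 : p ^ 2 < Nat.card (GaloisField p (2 * l)) :=
    (Nat.pow_lt_pow_right hp1 (by norm_num)).trans hL4
  have hLL : Nat.card (GaloisField p (2 * l)) * Nat.card (GaloisField p (2 * l)) =
      p ^ (2 * (2 * l)) := by rw [hL, ← pow_add, two_mul (2 * l)]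
  cases hf with
  | commutative _ _ _ hcomm => exact not_commutative hA E hcomm
  | largeNucleus _ _ hf hnuc => exact false_of_largeNucleus hA hL2 hB E hf (by rwa [hL])
  | dickson => exact false_of_dickson hA hL2 hB E
  | knuthI => exact false_of_knuthI hA hL2 hB E
  | knuthII => exact false_of_knuthII hA hL2 hB E
  | knuthIII => exact false_of_knuthIII hA hL2 hB E
  | knuthIV => exact false_of_knuthIV hA hL2 hB E
  | bierbrauer => exact false_of_bierbrauer hA hB E
  | dempwolff s t a b hfix hsq hf => exact false_of_dempwolff hA hL4 hB hfix hsq hf E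
  | dempwolffForm s t M b hM hf => exact false_of_dempwolffForm hA (by omega) hL hB hM hf E
  | zhouPott =>
    refine not_commutative hA E fun x y => ?_
    simp only [zhouPottMul, Prod.mk.injEq]
    constructor
    · rw [mul_comm _ y.1, mul_comm x.1, mul_comm _ y.2, mul_comm x.2, add_comm (y.1 * _),
        add_comm (y.2 * _)]
    · ring
  | taniguchi => exact false_of_taniguchi hA hB E
  | albert =>
    refine false_of_albert hA hL2 ?_ hB E
    rw [hLL, GaloisField.card p _ (by omega)]
  | twistedCyclic d n hd hdn s r M b hM hf =>
    have hn : 0 < n := Nat.pos_of_ne_zero (by rintro rfl; omega)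
    rcases Nat.lt_or_ge 1 d with hd1 | hd1
    · exact false_of_twistedCyclic hA hd1 hn (GaloisField.card p n hn.ne') hl hl11 hdn hd hB hM hf E
    · obtain rfl : d = 1 := by omega
      refine false_of_twistedCyclic_one hA hL2 ?_ hB E
      rw [hLL, GaloisField.card p n hn.ne', ← hdn, one_mul]

end Semifields

theorem mainTheorem7 (p : ℕ) [Fact p.Prime] (hp : p ≠ 2) :
    {m : ℕ | ∃ (σ τ : RingAut (GaloisField p m)) (α η : GaloisField p m),
      Semifields.IsNewParameter σ τ α η ∧ τ η = η ∧
      Semifields.IsPresemifield (Semifields.newMul σ τ α η) ∧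
      ∀ (W : Type) [AddCommGroup W] (f : W → W → W), Semifields.IsKnown p m f →
        ¬ Semifields.Equivalent p (Semifields.newMul σ τ α η) f}.Infinite := by
  refine Set.infinite_of_forall_exists_gt fun a => ?_
  obtain ⟨l, hla, hl⟩ := Nat.exists_infinite_primes (a + 11)
  obtain ⟨σ, α, η, hA, hnew, hη, hS⟩ := Semifields.exists_parameters (L := GaloisField p (2 * l))
    hp hl (by omega) (GaloisField.card p _ (by have := hl.pos; omega))
  exact ⟨2 * l, ⟨σ, σ ^ 3, α, η, hnew, hη, hS, fun W _ f hf =>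
    Semifields.not_equivalent_of_isKnown hl (by omega) hA hf⟩, by omega⟩
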